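/- Let $\mathcal X,\mathcal S,\mathcal Y,\mathcal Z$ be finite alphabets, let $Q_S$ be a probability mass function on $\mathcal S$, let $W_{Y,Z|X,S}$ be a channel from $\mathcal X\times\mathcal S$ to $\mathcal Y\times\mathcal Z$, and let $x_0\in\mathcal X$. The states $S_1,S_2,\dots$ are i.i.d. with law $Q_S$, and given inputs and states the outputs $(Y_i,Z_i)$ are produced memorylessly by $W_{Y,Z|X,S}$. Write $Q_0(z)=\sum_s Q_S(s)\sum_y W_{Y,Z|X,S}(y,z|x_0,s)$ for the law of $Z$ when the innocent symbol $x_0$ is sent. Logarithms are to base $2$. A code of length $n$ with message set of size $\lceil 2^{nR}\rceil$, with strictly causal state information at the transmitter only, consists of an encoder producing $X_i\in\mathcal X$ from $(M,S^{i-1})$ (possibly also from finitely-valued local randomness of the transmitter that is independent of the message and the states) and a decoder producing $\hat M$ from $Y^n$; the message $M$ is uniform and independent of the states. A rate $R\ge 0$ is covertly achievable if there is a sequence of such codes with $\Pr(\hat M\neq M)\to 0$ and $\mathbb D(P_{Z^n}\Vert Q_0^{\otimes n})\to 0$ as $n\to\infty$. The covert capacity $C_{\mathrm{SC\text{-}T}}$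 is the supremum of the covertly achievable rates. (1) Suppose that $Q_0(z)>0$ for every $z\in\mathcal Z$. Let $\mathcal D$ be the set of joint laws $P_{S,V,X,Y,Z}$, with $V$ taking values in a finite set $\mathcal V$ with $|\mathcal V|\le|\mathcal X|$, such that $$P_{S,V,X,Y,Z}=Q_S\,P_V\,P_{X|V}\,W_{Y,Z|X,S},\qquad P_Z=Q_0,\qquad I(X;Y)\ge I(V;Z),$$ and let $\mathcal A=\{R\ge 0:\ R\le I(X;Y)\text{ for some }P_{S,V,X,Y,Z}\in\mathcal D\}$. Then $\mathcal A$ has a maximum and $$C_{\mathrm{SC\text{-}T}}\le\max\mathcal A .$$ (2) Strictly causal state information at the transmitter does not increase the point-to-point capacity: the supremum of the rates $R\ge 0$ for which some sequence of the above codes satisfies $\Pr(\hat M\ne M)\to 0$ (with no covertness constraint) equals the ordinary capacity of the discrete memoryless channel $\overline W_{Y|X}(y|x)=\sum_s Q_S(s)\sum_z W_{Y,Z|X,S}(y,z|x,s)$, in which neither the transmitter nor the receiver knows the state. -/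

import Mathlib

open Filter Topology

noncomputable section

namespace CovertSC

/-! Finite alphabets are finite types, and a probability mass function on a finite type `α` is an
element of `stdSimplex ℝ α`.  A state-dependent channel is a family `W x s` of probability mass
functions on `𝒴 × 𝒵`, where `𝒴` is the output alphabet of the receiver and `𝒵` that of the
warden.  All logarithms are to base two. -/

section Information

variable {α β : Type*} [Fintype α] [Fintype β]

open Classical in
/-- Kullback-Leibler divergence of two mass functions on a finite type; it is infinite when the
first one is not absolutely continuous with respect to the second one. -/
def klDiv (p q : α → ℝ) : EReal :=
  if ∀ a, q a = 0 → p a = 0 then ((∑ a, p a * Real.logb 2 (p a / q a) : ℝ) : EReal) else ⊤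

/-- Mutual information of the two coordinates of a joint mass function. -/
def mutualInfo (p : α → β → ℝ) : ℝ :=
  ∑ a, ∑ b, p a b * Real.logb 2 (p a b / ((∑ b', p a b') * ∑ a', p a' b))

/-- The `n`-fold product of a mass function. -/
def productLaw (q : α → ℝ) (n : ℕ) : (Fin n → α) → ℝ := fun a => ∏ i, q (a i)

end Information

section Channel

variable {𝒳 𝒮 𝒴 𝒵 : Type*} [Fintype 𝒳] [Fintype 𝒮] [Fintype 𝒴] [Fintype 𝒵]

/-- The law of one output symbol of the warden while the innocent symbol `x₀` is sent. -/
def innocentLaw (QS : 𝒮 → ℝ) (W : 𝒳 → 𝒮 → 𝒴 × 𝒵 → ℝ) (x₀ : 𝒳) : 𝒵 → ℝ :=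
  fun z => ∑ s, QS s * ∑ y, W x₀ s (y, z)

/-- The ordinary channel from the input to the receiver that results when nobody observes the
state. -/
def stateAveraged (QS : 𝒮 → ℝ) (W : 𝒳 → 𝒮 → 𝒴 × 𝒵 → ℝ) : 𝒳 → 𝒴 → ℝ :=
  fun x y => ∑ s, QS s * ∑ z, W x s (y, z)

/-- The number of messages of a `(2 ^ (n R), n)` code. -/
def numMessages (R : ℝ) (n : ℕ) : ℕ := ⌈(2 : ℝ) ^ ((n : ℝ) * R)⌉₊

/-- A code of length `n` with `M` messages for state information that is available strictly
causally at the transmitter only: the `i`-th input symbol depends on the message, on the states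
before time `i`, and on local randomness of the transmitter (a seed that is independent of the
message and the states and takes finitely many values; one value gives a deterministic encoder).
The decoder sees the receiver's outputs only. -/
structure SCCode (𝒳 𝒮 𝒴 : Type*) (M n : ℕ) where
  seeds : ℕ
  seedLaw : Fin seeds → ℝ
  seedLaw_mem : seedLaw ∈ stdSimplex ℝ (Fin seeds)
  enc : Fin M → Fin seeds → (i : Fin n) → (Fin i → 𝒮) → 𝒳
  dec : (Fin n → 𝒴) → Fin M

namespace SCCode

variable {M n : ℕ}

/-- The input sequence for a message, a seed and a state sequence. -/
def input (c : SCCode 𝒳 𝒮 𝒴 M n) (m : Fin M) (θ : Fin c.seeds) (s : Fin n → 𝒮) : Fin n → 𝒳 :=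
  fun i => c.enc m θ i (fun j => s (Fin.castLE i.isLt.le j))

/-- Joint law of message, seed, states and both output sequences: the message is uniform, the
states are independent and identically distributed, the channel is memoryless. -/
def jointLaw (c : SCCode 𝒳 𝒮 𝒴 M n) (QS : 𝒮 → ℝ) (W : 𝒳 → 𝒮 → 𝒴 × 𝒵 → ℝ)
    (m : Fin M) (θ : Fin c.seeds) (s : Fin n → 𝒮) (y : Fin n → 𝒴) (z : Fin n → 𝒵) : ℝ :=
  (1 / (M : ℝ)) * c.seedLaw θ * ∏ i, (QS (s i) * W (c.input m θ s i) (s i) (y i, z i))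

/-- The probability that the decoded message differs from the transmitted one. -/
def errorProb (c : SCCode 𝒳 𝒮 𝒴 M n) (QS : 𝒮 → ℝ) (W : 𝒳 → 𝒮 → 𝒴 × 𝒵 → ℝ) : ℝ :=
  ∑ m, ∑ θ, ∑ s : Fin n → 𝒮, ∑ y : Fin n → 𝒴, ∑ z : Fin n → 𝒵,
    if c.dec y = m then 0 else c.jointLaw QS W m θ s y z

/-- The law of the warden's output sequence. -/
def wardenLaw (c : SCCode 𝒳 𝒮 𝒴 M n) (QS : 𝒮 → ℝ) (W : 𝒳 → 𝒮 → 𝒴 × 𝒵 → ℝ) :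
    (Fin n → 𝒵) → ℝ :=
  fun z => ∑ m, ∑ θ, ∑ s : Fin n → 𝒮, ∑ y : Fin n → 𝒴, c.jointLaw QS W m θ s y z

end SCCode

/-- `R` is an achievable covert rate. -/
def CovertAchievable (QS : 𝒮 → ℝ) (W : 𝒳 → 𝒮 → 𝒴 × 𝒵 → ℝ) (x₀ : 𝒳) (R : ℝ) : Prop :=
  0 ≤ R ∧ ∃ c : ∀ n, SCCode 𝒳 𝒮 𝒴 (numMessages R n) n,
    Tendsto (fun n => (c n).errorProb QS W) atTop (𝓝 0) ∧
    Tendsto (fun n => klDiv ((c n).wardenLaw QS W) (productLaw (innocentLaw QS W x₀) n))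
      atTop (𝓝 0)

/-- The covert capacity: the supremum of the achievable covert rates. -/
def covertCapacity (QS : 𝒮 → ℝ) (W : 𝒳 → 𝒮 → 𝒴 × 𝒵 → ℝ) (x₀ : 𝒳) : EReal :=
  sSup ((fun R : ℝ => (R : EReal)) '' {R | CovertAchievable QS W x₀ R})

/-- `R` is achievable, without any covertness constraint, with strictly causal state information
at the transmitter. -/
def SCAchievable (QS : 𝒮 → ℝ) (W : 𝒳 → 𝒮 → 𝒴 × 𝒵 → ℝ) (R : ℝ) : Prop :=
  0 ≤ R ∧ ∃ c : ∀ n, SCCode 𝒳 𝒮 𝒴 (numMessages R n) n,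
    Tendsto (fun n => (c n).errorProb QS W) atTop (𝓝 0)

/-- The capacity, without any covertness constraint, with strictly causal state information at the
transmitter. -/
def scCapacity (QS : 𝒮 → ℝ) (W : 𝒳 → 𝒮 → 𝒴 × 𝒵 → ℝ) : EReal :=
  sSup ((fun R : ℝ => (R : EReal)) '' {R | SCAchievable QS W R})

/-- A code of length `n` with `M` messages for an ordinary point-to-point channel. -/
structure PlainCode (𝒳 𝒴 : Type*) (M n : ℕ) where
  enc : Fin M → Fin n → 𝒳
  dec : (Fin n → 𝒴) → Fin M

/-- The error probability, for a uniform message, on the discrete memoryless channel `V`. -/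
def PlainCode.errorProb {M n : ℕ} (c : PlainCode 𝒳 𝒴 M n) (V : 𝒳 → 𝒴 → ℝ) : ℝ :=
  ∑ m, ∑ y : Fin n → 𝒴, if c.dec y = m then 0 else (1 / (M : ℝ)) * ∏ i, V (c.enc m i) (y i)

/-- `R` is an achievable rate of the discrete memoryless channel `V`. -/
def PlainAchievable (V : 𝒳 → 𝒴 → ℝ) (R : ℝ) : Prop :=
  0 ≤ R ∧ ∃ c : ∀ n, PlainCode 𝒳 𝒴 (numMessages R n) n,
    Tendsto (fun n => (c n).errorProb V) atTop (𝓝 0)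

/-- The capacity of the discrete memoryless channel `V`. -/
def plainCapacity (V : 𝒳 → 𝒴 → ℝ) : EReal :=
  sSup ((fun R : ℝ => (R : EReal)) '' {R | PlainAchievable V R})

/-- The admissible joint laws of `(S, V, X, Y, Z)`, with the auxiliary variable `V` in a set of `k`
elements: the law factors as `Q_S P_V P_{X|V} W_{Y,Z|X,S}`, the law of `Z` is the innocent one,
`I(X;Y) ≥ I(V;Z)`, and `k ≤ |𝒳|`. -/
structure Admissible (QS : 𝒮 → ℝ) (W : 𝒳 → 𝒮 → 𝒴 × 𝒵 → ℝ) (x₀ : 𝒳) (k : ℕ)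
    (P : 𝒮 → Fin k → 𝒳 → 𝒴 → 𝒵 → ℝ) : Prop where
  factors : ∃ PV ∈ stdSimplex ℝ (Fin k), ∃ PXV : Fin k → 𝒳 → ℝ, (∀ v, PXV v ∈ stdSimplex ℝ 𝒳) ∧
    ∀ s v x y z, P s v x y z = QS s * PV v * PXV v x * W x s (y, z)
  law_Z : ∀ z, ∑ s, ∑ v, ∑ x, ∑ y, P s v x y z = innocentLaw QS W x₀ z
  info_le : mutualInfo (fun v z => ∑ s, ∑ x, ∑ y, P s v x y z) ≤
    mutualInfo (fun x y => ∑ s, ∑ v, ∑ z, P s v x y z)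
  card_le : k ≤ Fintype.card 𝒳

/-- The rates `R ≥ 0` with `R ≤ I(X;Y)` for some admissible joint law. -/
def rateRegion (QS : 𝒮 → ℝ) (W : 𝒳 → 𝒮 → 𝒴 × 𝒵 → ℝ) (x₀ : 𝒳) : Set ℝ :=
  {R | 0 ≤ R ∧ ∃ (k : ℕ) (P : 𝒮 → Fin k → 𝒳 → 𝒴 → 𝒵 → ℝ), Admissible QS W x₀ k P ∧
    R ≤ mutualInfo (fun x y => ∑ s, ∑ v, ∑ z, P s v x y z)}

end Channel

end CovertSC

end

open CovertSC

open Filter Topology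

set_option linter.unusedSectionVars false

/-! Both claims rest on one observation: $X_i$ is a function of the message, the seed and $S^{i-1}$,
hence independent of $S_i$, so each letter passes through the state-averaged channels $V$ to the
receiver (`stateAveraged`) and to the warden (`wardenAveraged`).

Converse. Reweighting each output by $q(y_i)/V(y_i|x_i)$ and summing over the states causally leaves
a receiver law that does not depend on the message (`sum_jointLaw_mul_ratio_le`). Together with $\ln
t\le t-1$ this gives a Fano-type bound for one code (`log_le_sum_inputLaw`). With $q$ the output law
of the time-averaged input law $\bar p$, its right side is exactly $nI(\bar p,V)$, so asymptotically
$R\le I(\bar p,V)$ (`eventually_le_channelInfo`).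

Claim (2). Random coding achieves every nonnegative rate below $I(p,V)$
(`plainAchievable_of_lt_channelInfo`); with $p=\bar p$ the converse closes the gap. Conversely, the
encoder may ignore the states.

Claim (1). A weak Pinsker inequality turns vanishing divergence into vanishing $\ell^1$ distance,
which passes to single letters and to their average. A limit point of the laws $\bar p$ thus induces
exactly $Q_0$ at the warden, and continuity gives $R\le I(X;Y)$ there. A constant auxiliary variable
has $I(V;Z)=0$, so the constraint $I(X;Y)\ge I(V;Z)$ excludes no such input law, and $\max\mathcal
A$ is the maximum of a continuous function on the compact set `covertInputs`. -/

namespace CovertSC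

/-! ### Sums of products over finite sequences -/

section ProductSums

variable {A B : Type*} [Fintype A] [Fintype B]

lemma sum_snoc {n : ℕ} (f : (Fin (n + 1) → A) → ℝ) :
    ∑ a, f a = ∑ a : Fin n → A, ∑ b, f (Fin.snoc (α := fun _ => A) a b) := by
  rw [← (Fin.snocEquiv (fun _ : Fin (n + 1) => A)).sum_comp, Fintype.sum_prod_type_right]
  rfl

/-- The entries of a finite sequence before a given time. -/
def before {C : Type*} {n : ℕ} (a : Fin n → C) (i : Fin n) : Fin i → C :=
  fun j => a (Fin.castLE i.isLt.le j)

lemma before_snoc_castSucc {C : Type*} {n : ℕ} (a : Fin n → C) (b : C) (i : Fin n) :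
    before (Fin.snoc (α := fun _ => C) a b) i.castSucc = before a i := by
  funext j
  exact Fin.snoc_castSucc (α := fun _ => C) b a (Fin.castLE i.isLt.le j)

lemma before_snoc_last {C : Type*} {n : ℕ} (a : Fin n → C) (b : C) :
    before (Fin.snoc (α := fun _ => C) a b) (Fin.last n) = a := by
  funext j
  exact Fin.snoc_castSucc (α := fun _ => C) b a j

/-- Summing a product of causal kernels one coordinate at a time. -/
lemma sum_causal_prod_le {n : ℕ} (F : (i : Fin n) → (Fin i → A) → A → ℝ)
    (hF : ∀ i a b, 0 ≤ F i a b) (c : Fin n → ℝ) (hc₀ : ∀ i, 0 ≤ c i)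
    (hc : ∀ i a, ∑ b, F i a b ≤ c i) :
    ∑ a : Fin n → A, ∏ i, F i (before a i) (a i) ≤ ∏ i, c i := by
  induction n with
  | zero => simp
  | succ n ih =>
    rw [sum_snoc, Fin.prod_univ_castSucc]
    have h1 : ∀ (a : Fin n → A) (b : A),
        ∏ i, F i (before (Fin.snoc (α := fun _ => A) a b) i) (Fin.snoc (α := fun _ => A) a b i) =
          (∏ i : Fin n, F i.castSucc (before a i) (a i)) * F (Fin.last n) a b := by
      intro a b
      rw [Fin.prod_univ_castSucc]
      congr 1
      · refine Finset.prod_congr rfl fun i _ => ?_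
        rw [before_snoc_castSucc, Fin.snoc_castSucc]
      · rw [before_snoc_last, Fin.snoc_last]
    simp only [h1, ← Finset.mul_sum]
    have h2 := ih (fun i => F i.castSucc) (fun i a b => hF i.castSucc a b) (fun i => c i.castSucc)
      (fun i => hc₀ _) (fun i a => hc i.castSucc a)
    have h3 : ∀ a : Fin n → A, 0 ≤ ∏ i : Fin n, F i.castSucc (before a i) (a i) :=
      fun a => Finset.prod_nonneg fun i _ => hF _ _ _
    calc ∑ a : Fin n → A, (∏ i : Fin n, F i.castSucc (before a i) (a i)) * ∑ b, F (Fin.last n) a b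
        ≤ ∑ a : Fin n → A, (∏ i : Fin n, F i.castSucc (before a i) (a i)) * c (Fin.last n) :=
          Finset.sum_le_sum fun a _ => mul_le_mul_of_nonneg_left (hc (Fin.last n) a) (h3 a)
      _ ≤ _ := by
          rw [← Finset.sum_mul]
          exact mul_le_mul_of_nonneg_right h2 (hc₀ _)

lemma sum_prod_eq {n : ℕ} (h : Fin n → B → ℝ) :
    ∑ u : Fin n → B, ∏ j, h j (u j) = ∏ j, ∑ b, h j b := by
  classical
  rw [Finset.prod_univ_sum, Fintype.piFinset_univ]

lemma sum_sum_eq_sum_pair {C : Type*} [Fintype C] {n : ℕ}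
    (f : (Fin n → B) → (Fin n → C) → ℝ) :
    ∑ y, ∑ z, f y z = ∑ u : Fin n → B × C, f (fun i => (u i).1) (fun i => (u i).2) := by
  rw [← Fintype.sum_prod_type',
    ← (Equiv.arrowProdEquivProdArrow (Fin n) (fun _ => B) (fun _ => C)).sum_comp]
  rfl

lemma sum_prod_mul_apply {n : ℕ} (h : Fin n → B → ℝ) (hs : ∀ j, ∑ b, h j b = 1) (i : Fin n)
    (φ : B → ℝ) :
    ∑ u : Fin n → B, (∏ j, h j (u j)) * φ (u i) = ∑ b, h i b * φ b := by
  classical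
  have h1 : ∀ u : Fin n → B, (∏ j, h j (u j)) * φ (u i) =
      ∏ j, (h j (u j) * if j = i then φ (u j) else 1) := by
    intro u
    rw [Finset.prod_mul_distrib, Finset.prod_ite_eq' Finset.univ i]
    simp
  simp only [h1]
  rw [sum_prod_eq (fun j b => h j b * if j = i then φ b else 1),
    Finset.prod_eq_single i (fun j _ hj => by simp [hj, hs]) (by simp)]
  simp

/-- The `i`-th entry of an i.i.d. sequence is independent of the entries before it. -/
lemma sum_prod_mul_before {n : ℕ} (q : A → ℝ) (hq : ∑ a, q a = 1) (i : Fin n)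
    (ψ : (Fin i → A) → A → ℝ) :
    ∑ a : Fin n → A, (∏ j, q (a j)) * ψ (before a i) (a i) =
      ∑ a : Fin n → A, (∏ j, q (a j)) * ∑ b, q b * ψ (before a i) b := by
  induction n with
  | zero => exact i.elim0
  | succ n ih =>
    have h1 : ∀ (a : Fin n → A) (b : A), ∏ j, q (Fin.snoc (α := fun _ => A) a b j) =
        (∏ j, q (a j)) * q b := by
      intro a b
      rw [Fin.prod_univ_castSucc]
      simp only [Fin.snoc_castSucc, Fin.snoc_last]
    rw [sum_snoc, sum_snoc]
    induction i using Fin.lastCases with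
    | last =>
      simp only [before_snoc_last, Fin.snoc_last, h1]
      refine Finset.sum_congr rfl fun a _ => ?_
      rw [← Finset.sum_mul, ← Finset.mul_sum, hq, mul_one, Finset.mul_sum]
      exact Finset.sum_congr rfl fun b _ => mul_assoc _ _ _
    | cast i =>
      simp only [before_snoc_castSucc, Fin.snoc_castSucc, h1]
      have h2 : ∀ (a : Fin n → A) (t : ℝ), ∑ b, (∏ j, q (a j)) * q b * t = (∏ j, q (a j)) * t := by
        intro a t
        rw [← Finset.sum_mul, ← Finset.mul_sum, hq, mul_one]
      simp only [h2]
      exact ih i ψ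

/-- Second moment of a sum of independent, identically distributed, centred terms. -/
lemma sum_prod_mul_sq {n : ℕ} (q : A → ℝ) (hq : ∑ a, q a = 1) (ℓ : A → ℝ)
    (hℓ : ∑ a, q a * ℓ a = 0) :
    ∑ a : Fin n → A, (∏ j, q (a j)) * (∑ j, ℓ (a j)) ^ 2 = n * ∑ a, q a * ℓ a ^ 2 := by
  induction n with
  | zero => simp
  | succ n ih =>
    rw [sum_snoc]
    have h1 : ∀ (a : Fin n → A) (b : A), (∏ j, q (Fin.snoc (α := fun _ => A) a b j)) *
        (∑ j, ℓ (Fin.snoc (α := fun _ => A) a b j)) ^ 2 =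
        (∏ j, q (a j)) * (∑ j, ℓ (a j)) ^ 2 * q b +
          (∏ j, q (a j)) * 2 * (∑ j, ℓ (a j)) * (q b * ℓ b) + (∏ j, q (a j)) * (q b * ℓ b ^ 2) := by
      intro a b
      rw [Fin.prod_univ_castSucc, Fin.sum_univ_castSucc]
      simp only [Fin.snoc_castSucc, Fin.snoc_last]
      ring
    simp only [h1, Finset.sum_add_distrib, ← Finset.mul_sum, hq, hℓ, mul_zero,
      Finset.sum_const_zero, mul_one, ← Finset.sum_mul, ih]
    rw [sum_prod_eq (fun _ => q)]
    simp [hq]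
    ring

end ProductSums

/-! ### Single-letter laws and the converse for one code -/

section Converse

variable {𝒳 𝒮 𝒴 𝒵 : Type*} [Fintype 𝒳] [Fintype 𝒮] [Fintype 𝒴] [Fintype 𝒵]

lemma numMessages_pos (R : ℝ) (n : ℕ) : 0 < numMessages R n :=
  Nat.ceil_pos.2 (by positivity)

lemma sum_mul_sum_fst (QS : 𝒮 → ℝ) (W : 𝒳 → 𝒮 → 𝒴 × 𝒵 → ℝ) (x : 𝒳) (φ : 𝒴 → ℝ) :
    ∑ s, QS s * ∑ b, W x s b * φ b.1 = ∑ y, stateAveraged QS W x y * φ y := by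
  simp only [stateAveraged, Fintype.sum_prod_type, Finset.mul_sum, Finset.sum_mul]
  rw [Finset.sum_comm]
  simp only [mul_assoc]

lemma stateAveraged_mem {QS : 𝒮 → ℝ} (hQS : QS ∈ stdSimplex ℝ 𝒮) {W : 𝒳 → 𝒮 → 𝒴 × 𝒵 → ℝ}
    (hW : ∀ x s, W x s ∈ stdSimplex ℝ (𝒴 × 𝒵)) (x : 𝒳) :
    stateAveraged QS W x ∈ stdSimplex ℝ 𝒴 := by
  refine ⟨fun y => Finset.sum_nonneg fun s _ => mul_nonneg (hQS.1 s)
    (Finset.sum_nonneg fun z _ => (hW x s).1 _), ?_⟩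
  have h := sum_mul_sum_fst QS W x (fun _ => 1)
  simp only [mul_one, (hW x _).2, hQS.2] at h
  exact h.symm

/-- The ordinary channel from the input to the warden that results when nobody observes the
state. -/
def wardenAveraged (QS : 𝒮 → ℝ) (W : 𝒳 → 𝒮 → 𝒴 × 𝒵 → ℝ) : 𝒳 → 𝒵 → ℝ :=
  fun x z => ∑ s, QS s * ∑ y, W x s (y, z)

lemma sum_mul_sum_snd (QS : 𝒮 → ℝ) (W : 𝒳 → 𝒮 → 𝒴 × 𝒵 → ℝ) (x : 𝒳) (φ : 𝒵 → ℝ) :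
    ∑ s, QS s * ∑ b, W x s b * φ b.2 = ∑ z, wardenAveraged QS W x z * φ z := by
  simp only [wardenAveraged, Fintype.sum_prod_type_right, Finset.mul_sum, Finset.sum_mul]
  rw [Finset.sum_comm]
  simp only [mul_assoc]

lemma wardenAveraged_mem {QS : 𝒮 → ℝ} (hQS : QS ∈ stdSimplex ℝ 𝒮) {W : 𝒳 → 𝒮 → 𝒴 × 𝒵 → ℝ}
    (hW : ∀ x s, W x s ∈ stdSimplex ℝ (𝒴 × 𝒵)) (x : 𝒳) :
    wardenAveraged QS W x ∈ stdSimplex ℝ 𝒵 := by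
  refine ⟨fun y => Finset.sum_nonneg fun s _ => mul_nonneg (hQS.1 s)
    (Finset.sum_nonneg fun z _ => (hW x s).1 _), ?_⟩
  have h := sum_mul_sum_snd QS W x (fun _ => 1)
  simp only [mul_one, (hW x _).2, hQS.2] at h
  exact h.symm

namespace SCCode

variable {M n : ℕ} (c : SCCode 𝒳 𝒮 𝒴 M n) {QS : 𝒮 → ℝ} {W : 𝒳 → 𝒮 → 𝒴 × 𝒵 → ℝ}

open Classical in
/-- The law of the `i`-th input symbol. -/
noncomputable def inputLaw (QS : 𝒮 → ℝ) (i : Fin n) (x : 𝒳) : ℝ :=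
  ∑ m, ∑ θ, (1 / (M : ℝ)) * c.seedLaw θ *
    ∑ s : Fin n → 𝒮, (∏ j, QS (s j)) * if c.input m θ s i = x then 1 else 0

lemma sum_inputLaw_mul (i : Fin n) (φ : 𝒳 → ℝ) :
    ∑ x, c.inputLaw QS i x * φ x = ∑ m, ∑ θ, (1 / (M : ℝ)) * c.seedLaw θ *
      ∑ s : Fin n → 𝒮, (∏ j, QS (s j)) * φ (c.input m θ s i) := by
  classical
  simp only [inputLaw, Finset.sum_mul]
  rw [Finset.sum_comm]
  refine Finset.sum_congr rfl fun m _ => ?_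
  rw [Finset.sum_comm]
  refine Finset.sum_congr rfl fun θ _ => ?_
  simp only [mul_assoc, ← Finset.mul_sum, Finset.sum_mul]
  rw [Finset.sum_comm]
  simp

lemma sum_seed : ∑ _m : Fin M, ∑ θ, (1 / (M : ℝ)) * c.seedLaw θ = if M = 0 then 0 else 1 := by
  simp only [← Finset.mul_sum, c.seedLaw_mem.2]
  by_cases hM : M = 0
  · simp [hM]
  · simp [hM]

lemma inputLaw_mem (hQS : QS ∈ stdSimplex ℝ 𝒮) (hM : 0 < M) (i : Fin n) :
    c.inputLaw QS i ∈ stdSimplex ℝ 𝒳 := by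
  classical
  refine ⟨fun x => Finset.sum_nonneg fun m _ => Finset.sum_nonneg fun θ _ =>
    mul_nonneg (mul_nonneg (by positivity) (c.seedLaw_mem.1 θ)) (Finset.sum_nonneg fun s _ =>
      mul_nonneg (Finset.prod_nonneg fun j _ => hQS.1 _) (by split_ifs <;> simp)), ?_⟩
  have h := c.sum_inputLaw_mul (QS := QS) i (fun _ => 1)
  simp only [mul_one, sum_prod_eq (fun _ => QS), hQS.2, Finset.prod_const_one, c.sum_seed,
    hM.ne', if_false] at h
  exact h

/-- Strict causality enters here: the input at time $i$ sees only the earlier states, so the current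
state can be averaged afresh. Every single-letter expectation below is evaluated this way. -/
lemma sum_jointLaw_mul (hQS : QS ∈ stdSimplex ℝ 𝒮) (hW : ∀ x s, W x s ∈ stdSimplex ℝ (𝒴 × 𝒵))
    (i : Fin n) (φ : 𝒳 → 𝒴 → 𝒵 → ℝ) :
    ∑ m, ∑ θ, ∑ s : Fin n → 𝒮, ∑ y : Fin n → 𝒴, ∑ z : Fin n → 𝒵,
      c.jointLaw QS W m θ s y z * φ (c.input m θ s i) (y i) (z i) =
    ∑ x, c.inputLaw QS i x * ∑ s, QS s * ∑ b, W x s b * φ x b.1 b.2 := by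
  rw [c.sum_inputLaw_mul]
  refine Finset.sum_congr rfl fun m _ => Finset.sum_congr rfl fun θ _ => ?_
  have h := sum_prod_mul_before QS hQS.2 i (fun a s' => ∑ b, W (c.enc m θ i a) s' b *
    φ (c.enc m θ i a) b.1 b.2)
  refine Eq.trans ?_ (congrArg (fun t => (1 / (M : ℝ)) * c.seedLaw θ * t) h)
  rw [Finset.mul_sum]
  refine Finset.sum_congr rfl fun s _ => ?_
  rw [sum_sum_eq_sum_pair]
  have h2 := sum_prod_mul_apply (fun j => W (c.input m θ s j) (s j)) (fun j => (hW _ _).2) i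
    (fun b => φ (c.input m θ s i) b.1 b.2)
  refine Eq.trans ?_ (congrArg (fun t => (1 / (M : ℝ)) * c.seedLaw θ * ((∏ j, QS (s j)) * t)) h2)
  rw [Finset.mul_sum, Finset.mul_sum]
  refine Finset.sum_congr rfl fun u _ => ?_
  simp only [jointLaw, Finset.prod_mul_distrib]
  ring

lemma sum_jointLaw (hQS : QS ∈ stdSimplex ℝ 𝒮) (hW : ∀ x s, W x s ∈ stdSimplex ℝ (𝒴 × 𝒵))
    (hM : 0 < M) :
    ∑ m, ∑ θ, ∑ s : Fin n → 𝒮, ∑ y : Fin n → 𝒴, ∑ z : Fin n → 𝒵, c.jointLaw QS W m θ s y z = 1 := by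
  have h1 : ∀ m θ, ∑ s : Fin n → 𝒮, ∑ y : Fin n → 𝒴, ∑ z : Fin n → 𝒵, c.jointLaw QS W m θ s y z =
      (1 / (M : ℝ)) * c.seedLaw θ := by
    intro m θ
    have h2 : ∀ s : Fin n → 𝒮, ∑ y : Fin n → 𝒴, ∑ z : Fin n → 𝒵, c.jointLaw QS W m θ s y z =
        (1 / (M : ℝ)) * c.seedLaw θ * ∏ j, QS (s j) := by
      intro s
      rw [sum_sum_eq_sum_pair]
      simp only [jointLaw, Finset.prod_mul_distrib, ← Finset.mul_sum]
      rw [sum_prod_eq (fun j => W (c.input m θ s j) (s j))]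
      simp [(hW _ _).2]
    simp only [h2, ← Finset.mul_sum]
    rw [sum_prod_eq (fun _ => QS)]
    simp [hQS.2]
  simp only [h1, c.sum_seed, hM.ne', if_false]

lemma jointLaw_nonneg (hQS : QS ∈ stdSimplex ℝ 𝒮) (hW : ∀ x s, W x s ∈ stdSimplex ℝ (𝒴 × 𝒵))
    (m : Fin M) (θ : Fin c.seeds) (s : Fin n → 𝒮) (y : Fin n → 𝒴) (z : Fin n → 𝒵) :
    0 ≤ c.jointLaw QS W m θ s y z :=
  mul_nonneg (mul_nonneg (by positivity) (c.seedLaw_mem.1 θ)) (Finset.prod_nonneg fun i _ =>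
    mul_nonneg (hQS.1 _) ((hW _ _).1 _))

/-- With the next lemma, this keeps every logarithm in the converse finite on the support of the
joint law. -/
lemma inputLaw_pos_of_jointLaw_pos (hQS : QS ∈ stdSimplex ℝ 𝒮)
    {m : Fin M} {θ : Fin c.seeds} {s : Fin n → 𝒮} {y : Fin n → 𝒴} {z : Fin n → 𝒵}
    (h : c.jointLaw QS W m θ s y z ≠ 0) (i : Fin n) :
    0 < c.inputLaw QS i (c.input m θ s i) := by
  classical
  have hk : 0 < (1 / (M : ℝ)) * c.seedLaw θ :=
    lt_of_le_of_ne (mul_nonneg (by positivity) (c.seedLaw_mem.1 θ))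
      (Ne.symm (left_ne_zero_of_mul h))
  have hs : ∀ j, 0 < QS (s j) := fun j => lt_of_le_of_ne (hQS.1 _) (Ne.symm
    (left_ne_zero_of_mul (Finset.prod_ne_zero_iff.1 (right_ne_zero_of_mul h) j (Finset.mem_univ _))))
  have hn : ∀ (m' : Fin M) (θ' : Fin c.seeds) (s' : Fin n → 𝒮), 0 ≤ (∏ j, QS (s' j)) *
      if c.input m' θ' s' i = c.input m θ s i then (1 : ℝ) else 0 := fun m' θ' s' =>
    mul_nonneg (Finset.prod_nonneg fun j _ => hQS.1 _) (by split_ifs <;> simp)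
  have hn2 : ∀ (m' : Fin M) (θ' : Fin c.seeds), 0 ≤ (1 / (M : ℝ)) * c.seedLaw θ' *
      ∑ s' : Fin n → 𝒮, (∏ j, QS (s' j)) *
      if c.input m' θ' s' i = c.input m θ s i then (1 : ℝ) else 0 := fun m' θ' =>
    mul_nonneg (mul_nonneg (by positivity) (c.seedLaw_mem.1 θ')) (Finset.sum_nonneg fun s' _ =>
      hn m' θ' s')
  have h1 : 0 < ∑ s' : Fin n → 𝒮, (∏ j, QS (s' j)) *
      if c.input m θ s' i = c.input m θ s i then (1 : ℝ) else 0 :=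
    Finset.sum_pos' (fun s' _ => hn m θ s') ⟨s, Finset.mem_univ _, by
      simpa using Finset.prod_pos fun j _ => hs j⟩
  exact Finset.sum_pos' (fun m' _ => Finset.sum_nonneg fun θ' _ => hn2 m' θ')
    ⟨m, Finset.mem_univ _, Finset.sum_pos' (fun θ' _ => hn2 m θ')
      ⟨θ, Finset.mem_univ _, mul_pos hk h1⟩⟩

lemma stateAveraged_pos_of_jointLaw_ne_zero (hQS : QS ∈ stdSimplex ℝ 𝒮)
    (hW : ∀ x s, W x s ∈ stdSimplex ℝ (𝒴 × 𝒵))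
    {m : Fin M} {θ : Fin c.seeds} {s : Fin n → 𝒮} {y : Fin n → 𝒴} {z : Fin n → 𝒵}
    (h : c.jointLaw QS W m θ s y z ≠ 0) (i : Fin n) :
    0 < stateAveraged QS W (c.input m θ s i) (y i) := by
  have hi := Finset.prod_ne_zero_iff.1 (right_ne_zero_of_mul h) i (Finset.mem_univ _)
  have h1 := lt_of_le_of_ne (hQS.1 _) (Ne.symm (left_ne_zero_of_mul hi))
  have h2 := lt_of_le_of_ne ((hW _ _).1 _) (Ne.symm (right_ne_zero_of_mul hi))
  exact Finset.sum_pos' (fun s' _ => mul_nonneg (hQS.1 s') (Finset.sum_nonneg fun z' _ =>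
    (hW _ _).1 _)) ⟨s i, Finset.mem_univ _, mul_pos h1 (Finset.sum_pos' (fun z' _ =>
    (hW _ _).1 _) ⟨z i, Finset.mem_univ _, h2⟩)⟩

/-- Change of measure: reweighting every channel output by `q y / V x y` makes the receiver's
outputs independent of the message. -/
lemma sum_jointLaw_mul_ratio_le (hQS : QS ∈ stdSimplex ℝ 𝒮)
    (hW : ∀ x s, W x s ∈ stdSimplex ℝ (𝒴 × 𝒵)) {q : 𝒴 → ℝ} (hq : q ∈ stdSimplex ℝ 𝒴)
    (g : Fin M → (Fin n → 𝒴) → ℝ) (hg : ∀ m y, 0 ≤ g m y) :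
    ∑ m, ∑ θ, ∑ s : Fin n → 𝒮, ∑ y : Fin n → 𝒴, ∑ z : Fin n → 𝒵, c.jointLaw QS W m θ s y z *
      (g m y * ∏ i, (q (y i) / stateAveraged QS W (c.input m θ s i) (y i))) ≤
    ∑ m, (1 / (M : ℝ)) * ∑ y : Fin n → 𝒴, g m y * ∏ i, q (y i) := by
  have hV := stateAveraged_mem hQS hW
  refine Finset.sum_le_sum fun m _ => ?_
  have h1 : ∀ θ, ∑ s : Fin n → 𝒮, ∑ y : Fin n → 𝒴, ∑ z : Fin n → 𝒵, c.jointLaw QS W m θ s y z *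
      (g m y * ∏ i, (q (y i) / stateAveraged QS W (c.input m θ s i) (y i))) ≤
      c.seedLaw θ * ((1 / (M : ℝ)) * ∑ y : Fin n → 𝒴, g m y * ∏ i, q (y i)) := by
    intro θ
    -- With the receiver's sequence fixed, the warden's outputs sum out letter by letter, and what
    -- remains is a product of causal kernels in the states, each of total mass at most `q (y i)`.
    rw [Finset.sum_comm, Finset.mul_sum, Finset.mul_sum]
    refine Finset.sum_le_sum fun y _ => ?_
    set F : (i : Fin n) → (Fin i → 𝒮) → 𝒮 → ℝ := fun i a s =>
      QS s * (∑ z, W (c.enc m θ i a) s (y i, z)) *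
        (q (y i) / stateAveraged QS W (c.enc m θ i a) (y i)) with hF
    have h2 := sum_causal_prod_le F (fun i a s => mul_nonneg (mul_nonneg (hQS.1 _)
      (Finset.sum_nonneg fun z _ => (hW _ _).1 _)) (div_nonneg (hq.1 _) ((hV _).1 _)))
      (fun i => q (y i)) (fun i => hq.1 _) (fun i a => by
        rw [hF]
        simp only
        rw [← Finset.sum_mul]
        change stateAveraged QS W (c.enc m θ i a) (y i) * _ ≤ _
        -- Where the averaged channel vanishes, the ratio is `0` by the convention for division and
        -- mass is lost; hence an inequality only.
        by_cases h0 : stateAveraged QS W (c.enc m θ i a) (y i) = 0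
        · rw [h0, zero_mul]; exact hq.1 _
        · rw [mul_div_cancel₀ _ h0])
    have h3 : ∀ s : Fin n → 𝒮, ∑ z : Fin n → 𝒵, c.jointLaw QS W m θ s y z *
      (g m y * ∏ i, (q (y i) / stateAveraged QS W (c.input m θ s i) (y i))) =
      (c.seedLaw θ * (1 / (M : ℝ)) * g m y) * ∏ i, F i (before s i) (s i) := by
      intro s
      have h4 := sum_prod_eq (fun i z => W (c.input m θ s i) (s i) (y i, z))
      have h5 : ∏ i, F i (before s i) (s i) = (∏ i, QS (s i)) *
          (∏ i, ∑ z, W (c.input m θ s i) (s i) (y i, z)) *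
          ∏ i, (q (y i) / stateAveraged QS W (c.input m θ s i) (y i)) := by
        rw [← Finset.prod_mul_distrib, ← Finset.prod_mul_distrib]
        rfl
      rw [h5, ← h4, Finset.mul_sum, Finset.sum_mul, Finset.mul_sum]
      refine Finset.sum_congr rfl fun z _ => ?_
      simp only [jointLaw, Finset.prod_mul_distrib]
      ring
    simp only [h3, ← Finset.mul_sum]
    calc _ ≤ (c.seedLaw θ * (1 / (M : ℝ)) * g m y) * ∏ i, q (y i) :=
          mul_le_mul_of_nonneg_left h2 (mul_nonneg (mul_nonneg (c.seedLaw_mem.1 θ)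
            (by positivity)) (hg _ _))
      _ = _ := by ring
  refine (Finset.sum_le_sum fun θ _ => h1 θ).trans_eq ?_
  rw [← Finset.sum_mul, c.seedLaw_mem.2, one_mul]

/-- Converse for a single code. -/
lemma log_le_sum_inputLaw (hQS : QS ∈ stdSimplex ℝ 𝒮)
    (hW : ∀ x s, W x s ∈ stdSimplex ℝ (𝒴 × 𝒵)) (hM : 0 < M) {q : 𝒴 → ℝ} (hq : q ∈ stdSimplex ℝ 𝒴)
    (hac : ∀ i x y, 0 < c.inputLaw QS i x → 0 < stateAveraged QS W x y → 0 < q y) :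
    (1 - c.errorProb QS W) * Real.log M - 1 ≤ ∑ i, ∑ x, c.inputLaw QS i x *
      ∑ y, stateAveraged QS W x y * Real.log (stateAveraged QS W x y / q y) := by
  have hM' : (0 : ℝ) < M := by exact_mod_cast hM
  set V := stateAveraged QS W with hVdef
  -- The weight `M` on correct decoding produces the term $(1-P_e)\ln M$; the weight `1` on errors
  -- keeps the logarithm defined and contributes nothing.
  set g : Fin M → (Fin n → 𝒴) → ℝ := fun m y => if c.dec y = m then (M : ℝ) else 1 with hg
  have hgpos : ∀ m y, 0 < g m y := fun m y => by
    simp only [hg]; split_ifs <;> positivity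
  have hpt : ∀ m θ s y z, c.jointLaw QS W m θ s y z + (Real.log M * c.jointLaw QS W m θ s y z -
        Real.log M * if c.dec y = m then 0 else c.jointLaw QS W m θ s y z) ≤
      ∑ i, Real.log (V (c.input m θ s i) (y i) / q (y i)) *
        c.jointLaw QS W m θ s y z +
      c.jointLaw QS W m θ s y z * (g m y * ∏ i, (q (y i) / V (c.input m θ s i) (y i))) := by
    intro m θ s y z
    by_cases hJ : c.jointLaw QS W m θ s y z = 0
    · simp [hJ]
    have hJ' := lt_of_le_of_ne (c.jointLaw_nonneg hQS hW m θ s y z) (Ne.symm hJ)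
    have hVp : ∀ i, 0 < V (c.input m θ s i) (y i) := fun i =>
      c.stateAveraged_pos_of_jointLaw_ne_zero hQS hW hJ i
    have hqp : ∀ i, 0 < q (y i) := fun i =>
      hac i _ _ (c.inputLaw_pos_of_jointLaw_pos hQS hJ i) (hVp i)
    have hrp : ∀ i, 0 < q (y i) / V (c.input m θ s i) (y i) := fun i => div_pos (hqp i) (hVp i)
    have hlog := Real.log_le_sub_one_of_pos (mul_pos (hgpos m y)
      (Finset.prod_pos (s := Finset.univ) fun i _ => hrp i))
    rw [Real.log_mul (hgpos m y).ne' (Finset.prod_pos fun i _ => hrp i).ne',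
      Real.log_prod (fun i _ => (hrp i).ne')] at hlog
    have hsum : ∑ i, Real.log (q (y i) / V (c.input m θ s i) (y i)) =
        -∑ i, Real.log (V (c.input m θ s i) (y i) / q (y i)) := by
      rw [← Finset.sum_neg_distrib]
      refine Finset.sum_congr rfl fun i _ => ?_
      rw [← Real.log_inv, inv_div]
    rw [hsum] at hlog
    have hgl : Real.log M * c.jointLaw QS W m θ s y z -
        (Real.log M * if c.dec y = m then 0 else c.jointLaw QS W m θ s y z) =
        c.jointLaw QS W m θ s y z * Real.log (g m y) := by
      simp only [hg]; split_ifs <;> simp [mul_comm]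
    rw [hgl, ← Finset.sum_mul]
    nlinarith [mul_le_mul_of_nonneg_left hlog hJ'.le]
  have hsum := Finset.sum_le_sum fun m (_ : m ∈ Finset.univ) => Finset.sum_le_sum
    fun θ (_ : θ ∈ Finset.univ) => Finset.sum_le_sum fun s (_ : s ∈ Finset.univ) =>
    Finset.sum_le_sum fun y (_ : y ∈ Finset.univ) => Finset.sum_le_sum
    fun z (_ : z ∈ Finset.univ) => hpt m θ s y z
  simp only [Finset.sum_add_distrib, Finset.sum_sub_distrib, ← Finset.mul_sum] at hsum
  rw [c.sum_jointLaw hQS hW hM] at hsum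
  have hchange := c.sum_jointLaw_mul_ratio_le hQS hW hq g (fun m y => (hgpos m y).le)
  have hg2 : ∑ m, (1 / (M : ℝ)) * ∑ y : Fin n → 𝒴, g m y * ∏ i, q (y i) ≤ 2 := by
    rw [← Finset.mul_sum, Finset.sum_comm]
    simp only [← Finset.sum_mul]
    -- The decoded message contributes `M`, and each of the `M` messages at most `1` more.
    have hgs : ∀ y, ∑ m, g m y ≤ 2 * M := by
      intro y
      have h1 : ∀ m, g m y ≤ (if c.dec y = m then (M : ℝ) else 0) + 1 := fun m => by
        simp only [hg]; split_ifs <;> simp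
      refine (Finset.sum_le_sum fun m _ => h1 m).trans_eq ?_
      rw [Finset.sum_add_distrib, Finset.sum_ite_eq]
      simp; ring
    have h2 : ∑ y : Fin n → 𝒴, (∑ m, g m y) * ∏ i, q (y i) ≤ 2 * M := by
      calc _ ≤ ∑ y : Fin n → 𝒴, 2 * M * ∏ i, q (y i) := Finset.sum_le_sum fun y _ =>
            mul_le_mul_of_nonneg_right (hgs y) (Finset.prod_nonneg fun i _ => hq.1 _)
        _ = 2 * M := by
            rw [← Finset.mul_sum, sum_prod_eq (fun _ => q)]; simp [hq.2]
    rw [one_div, inv_mul_le_iff₀ hM']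
    linarith
  have hswap : ∑ m, ∑ θ, ∑ s : Fin n → 𝒮, ∑ y : Fin n → 𝒴, ∑ z : Fin n → 𝒵,
      ∑ i, Real.log (V (c.input m θ s i) (y i) / q (y i)) * c.jointLaw QS W m θ s y z =
      ∑ i, ∑ x, c.inputLaw QS i x * ∑ y, V x y * Real.log (V x y / q y) := by
    have h1 : ∀ i, ∑ x, c.inputLaw QS i x * ∑ y, V x y * Real.log (V x y / q y) =
        ∑ m, ∑ θ, ∑ s : Fin n → 𝒮, ∑ y : Fin n → 𝒴, ∑ z : Fin n → 𝒵,
        Real.log (V (c.input m θ s i) (y i) / q (y i)) * c.jointLaw QS W m θ s y z := by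
      intro i
      simp only [mul_comm (Real.log _) (c.jointLaw _ _ _ _ _ _ _)]
      rw [c.sum_jointLaw_mul hQS hW i (fun x y _ => Real.log (V x y / q y))]
      refine Finset.sum_congr rfl fun x _ => ?_
      rw [← sum_mul_sum_fst QS W x (fun y => Real.log (V x y / q y))]
    simp only [h1]
    symm
    rw [Finset.sum_comm]
    refine Finset.sum_congr rfl fun m _ => ?_
    rw [Finset.sum_comm]
    refine Finset.sum_congr rfl fun θ _ => ?_
    rw [Finset.sum_comm]
    refine Finset.sum_congr rfl fun s _ => ?_
    rw [Finset.sum_comm]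
    refine Finset.sum_congr rfl fun y _ => ?_
    rw [Finset.sum_comm]
  rw [hswap] at hsum
  change 1 + (Real.log M * 1 - Real.log M * c.errorProb QS W) ≤ _ at hsum
  linarith

end SCCode

end Converse

/-! ### Mutual information of a channel and a Pinsker inequality -/

section ChannelInfo

variable {𝒳 𝒴 : Type*} [Fintype 𝒳] [Fintype 𝒴]

/-- The mutual information between the input and the output of a channel `V` with input law `p`. -/
noncomputable def channelInfo (p : 𝒳 → ℝ) (V : 𝒳 → 𝒴 → ℝ) : ℝ :=
  mutualInfo fun x y => p x * V x y

lemma channelInfo_eq (p : 𝒳 → ℝ) {V : 𝒳 → 𝒴 → ℝ} (hV : ∀ x, V x ∈ stdSimplex ℝ 𝒴) :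
    channelInfo p V =
      ∑ x, p x * ∑ y, V x y * Real.logb 2 (V x y / ∑ x', p x' * V x' y) := by
  unfold channelInfo mutualInfo
  refine Finset.sum_congr rfl fun x _ => ?_
  rw [Finset.mul_sum]
  refine Finset.sum_congr rfl fun y _ => ?_
  rw [← Finset.mul_sum, (hV x).2, mul_one]
  by_cases hx : p x = 0
  · simp [hx]
  · rw [mul_div_mul_left _ _ hx, mul_assoc]

lemma output_pos {p : 𝒳 → ℝ} (hp : ∀ x, 0 ≤ p x) {V : 𝒳 → 𝒴 → ℝ} (hV : ∀ x y, 0 ≤ V x y)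
    {x : 𝒳} {y : 𝒴} (hx : 0 < p x) (hy : 0 < V x y) : 0 < ∑ x', p x' * V x' y :=
  Finset.sum_pos' (fun x' _ => mul_nonneg (hp x') (hV x' y)) ⟨x, Finset.mem_univ _, mul_pos hx hy⟩

lemma output_mem {p : 𝒳 → ℝ} (hp : p ∈ stdSimplex ℝ 𝒳) {V : 𝒳 → 𝒴 → ℝ}
    (hV : ∀ x, V x ∈ stdSimplex ℝ 𝒴) : (fun y => ∑ x, p x * V x y) ∈ stdSimplex ℝ 𝒴 := by
  refine ⟨fun y => Finset.sum_nonneg fun x _ => mul_nonneg (hp.1 x) ((hV x).1 y), ?_⟩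
  rw [Finset.sum_comm]
  simp only [← Finset.mul_sum, (hV _).2, mul_one, hp.2]

/-- On the simplex $I(X;Y)=H(Y)-H(Y|X)$: the conditional entropy is linear in the input law and
$t\mapsto -t\ln t$ is continuous, also at $0$. -/
lemma continuousOn_channelInfo {V : 𝒳 → 𝒴 → ℝ} (hV : ∀ x, V x ∈ stdSimplex ℝ 𝒴) :
    ContinuousOn (fun p => channelInfo p V) (stdSimplex ℝ 𝒳) := by
  have hc : Continuous fun p : 𝒳 → ℝ => (∑ x, p x * ∑ y, V x y * Real.log (V x y) +
      ∑ y, Real.negMulLog (∑ x, p x * V x y)) / Real.log 2 := by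
    fun_prop
  refine hc.continuousOn.congr fun p hp => ?_
  simp only [channelInfo_eq p hV, Real.logb, Real.negMulLog]
  simp only [neg_mul, Finset.sum_neg_distrib, Finset.sum_mul]
  rw [Finset.sum_comm (f := fun y x => p x * V x y * _), ← sub_eq_add_neg,
    ← Finset.sum_sub_distrib, Finset.sum_div]
  refine Finset.sum_congr rfl fun x _ => ?_
  rw [Finset.mul_sum, Finset.mul_sum, ← Finset.sum_sub_distrib, Finset.sum_div]
  refine Finset.sum_congr rfl fun y _ => ?_
  by_cases hx : p x = 0
  · simp [hx]
  by_cases hy : V x y = 0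
  · simp [hy]
  have hq := output_pos hp.1 (fun x => (hV x).1) (lt_of_le_of_ne (hp.1 x) (Ne.symm hx))
    (lt_of_le_of_ne ((hV x).1 y) (Ne.symm hy))
  rw [Real.log_div hy hq.ne']
  ring

lemma channelInfo_single [DecidableEq 𝒳] (x₀ : 𝒳) {V : 𝒳 → 𝒴 → ℝ}
    (hV : ∀ x, V x ∈ stdSimplex ℝ 𝒴) : channelInfo (Pi.single x₀ 1) V = 0 := by
  rw [channelInfo_eq _ hV]
  have h : ∀ a : ℝ, a * Real.logb 2 (a / a) = 0 := fun a => by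
    by_cases ha : a = 0 <;> simp [ha]
  simp [Pi.single_apply, h]

/-- A weak form of Pinsker's inequality. -/
lemma sq_sum_abs_sub_le {α : Type*} [Fintype α] {p q : α → ℝ} (hp : p ∈ stdSimplex ℝ α)
    (hq : q ∈ stdSimplex ℝ α) (hq' : ∀ a, 0 < q a) :
    (∑ a, |p a - q a|) ^ 2 ≤ 4 * Real.log 2 * ∑ a, p a * Real.logb 2 (p a / q a) := by
  -- This is $\ln t\le t-1$ at $t=\sqrt{q/p}$; summed over the letters, it bounds the squared
  -- Hellinger distance by the divergence.
  have hpt : ∀ a, (√(p a) - √(q a)) ^ 2 ≤ p a * Real.log (p a / q a) - p a + q a := by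
    intro a
    have hqs := Real.sq_sqrt (hq' a).le
    have hps := Real.sq_sqrt (hp.1 a)
    rcases (hp.1 a).eq_or_lt with h | h
    · simp [← h, (hq' a).le]
    · have hr : 0 < √(q a) / √(p a) := by
        have := Real.sqrt_pos.2 h; have := Real.sqrt_pos.2 (hq' a); positivity
      have hl := Real.log_le_sub_one_of_pos hr
      have hl2 : Real.log (p a / q a) = -2 * Real.log (√(q a) / √(p a)) := by
        rw [Real.log_div h.ne' (hq' a).ne', Real.log_div (Real.sqrt_pos.2 (hq' a)).ne'
          (Real.sqrt_pos.2 h).ne', Real.log_sqrt h.le, Real.log_sqrt (hq' a).le]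
        ring
      have h3 : p a * (√(q a) / √(p a)) = √(p a) * √(q a) := by
        have := (Real.sqrt_pos.2 h).ne'
        field_simp
        rw [hps, mul_comm]
      rw [hl2]
      nlinarith [mul_le_mul_of_nonneg_left hl h.le]
  have hH : ∑ a, (√(p a) - √(q a)) ^ 2 ≤ ∑ a, p a * Real.log (p a / q a) := by
    refine (Finset.sum_le_sum fun a _ => hpt a).trans_eq ?_
    rw [Finset.sum_add_distrib, Finset.sum_sub_distrib, hp.2, hq.2]
    ring
  have hS : ∑ a, (√(p a) + √(q a)) ^ 2 ≤ 4 := by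
    have h1 : ∀ a, (√(p a) + √(q a)) ^ 2 ≤ 2 * (p a + q a) := fun a => by
      nlinarith [Real.sq_sqrt (hq' a).le, Real.sq_sqrt (hp.1 a), sq_nonneg (√(p a) - √(q a))]
    refine (Finset.sum_le_sum fun a _ => h1 a).trans_eq ?_
    rw [← Finset.mul_sum, Finset.sum_add_distrib, hp.2, hq.2]
    norm_num
  have habs : ∀ a, |p a - q a| = |√(p a) - √(q a)| * (√(p a) + √(q a)) := by
    intro a
    rw [← abs_of_nonneg (show 0 ≤ √(p a) + √(q a) by positivity), ← abs_mul]
    congr 1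
    nlinarith [Real.sq_sqrt (hq' a).le, Real.sq_sqrt (hp.1 a)]
  -- Cauchy–Schwarz for $|p-q|=|\sqrt p-\sqrt q|(\sqrt p+\sqrt q)$; the factor 4 is the bound `hS`
  -- on the second sum of squares.
  have hCS := Finset.sum_mul_sq_le_sq_mul_sq Finset.univ (fun a => |√(p a) - √(q a)|)
    (fun a => √(p a) + √(q a))
  simp only [sq_abs, ← habs] at hCS
  have hlog : 4 * Real.log 2 * ∑ a, p a * Real.logb 2 (p a / q a) =
      4 * ∑ a, p a * Real.log (p a / q a) := by
    rw [mul_assoc, Finset.mul_sum]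
    congr 1
    refine Finset.sum_congr rfl fun a _ => ?_
    rw [Real.logb]
    have : Real.log 2 ≠ 0 := (Real.log_pos one_lt_two).ne'
    field_simp
  rw [hlog]
  have h0 : 0 ≤ ∑ a, (√(p a) - √(q a)) ^ 2 := Finset.sum_nonneg fun a _ => sq_nonneg _
  nlinarith

end ChannelInfo

/-! ### Time averaging and asymptotic converse -/

section Converse

variable {𝒳 𝒮 𝒴 𝒵 : Type*} [Fintype 𝒳] [Fintype 𝒮] [Fintype 𝒴] [Fintype 𝒵]

namespace SCCode

variable {M n : ℕ} (c : SCCode 𝒳 𝒮 𝒴 M n) {QS : 𝒮 → ℝ} {W : 𝒳 → 𝒮 → 𝒴 × 𝒵 → ℝ}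

lemma sum_wardenLaw_mul (hQS : QS ∈ stdSimplex ℝ 𝒮) (hW : ∀ x s, W x s ∈ stdSimplex ℝ (𝒴 × 𝒵))
    (i : Fin n) (φ : 𝒵 → ℝ) :
    ∑ z, c.wardenLaw QS W z * φ (z i) =
      ∑ x, c.inputLaw QS i x * ∑ z, wardenAveraged QS W x z * φ z := by
  have h := c.sum_jointLaw_mul hQS hW i (fun _ _ z => φ z)
  simp only [← sum_mul_sum_snd]
  rw [← h]
  simp only [wardenLaw, Finset.sum_mul]
  rw [Finset.sum_comm]
  refine Finset.sum_congr rfl fun m _ => ?_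
  rw [Finset.sum_comm]
  refine Finset.sum_congr rfl fun θ _ => ?_
  rw [Finset.sum_comm]
  refine Finset.sum_congr rfl fun s _ => ?_
  rw [Finset.sum_comm]

lemma wardenLaw_mem (hQS : QS ∈ stdSimplex ℝ 𝒮) (hW : ∀ x s, W x s ∈ stdSimplex ℝ (𝒴 × 𝒵))
    (hM : 0 < M) : c.wardenLaw QS W ∈ stdSimplex ℝ (Fin n → 𝒵) := by
  refine ⟨fun z => Finset.sum_nonneg fun m _ => Finset.sum_nonneg fun θ _ =>
    Finset.sum_nonneg fun s _ => Finset.sum_nonneg fun y _ => c.jointLaw_nonneg hQS hW m θ s y z, ?_⟩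
  rw [← c.sum_jointLaw hQS hW hM]
  simp only [wardenLaw]
  rw [Finset.sum_comm]
  refine Finset.sum_congr rfl fun m _ => ?_
  rw [Finset.sum_comm]
  refine Finset.sum_congr rfl fun θ _ => ?_
  rw [Finset.sum_comm]
  refine Finset.sum_congr rfl fun s _ => ?_
  rw [Finset.sum_comm]

/-- Every letter of the warden's output is close to `Q` when the whole sequence is close to the
product law. -/
lemma abs_inputLaw_sub_le (hQS : QS ∈ stdSimplex ℝ 𝒮)
    (hW : ∀ x s, W x s ∈ stdSimplex ℝ (𝒴 × 𝒵)) {Q : 𝒵 → ℝ} (hQ : Q ∈ stdSimplex ℝ 𝒵)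
    (i : Fin n) (z₀ : 𝒵) :
    |∑ x, c.inputLaw QS i x * wardenAveraged QS W x z₀ - Q z₀| ≤
      ∑ z, |c.wardenLaw QS W z - productLaw Q n z| := by
  classical
  -- Testing with the indicator of `z₀` at coordinate `i` extracts the marginals, whose difference
  -- is at most the full $\ell^1$ distance.
  have h1 := c.sum_wardenLaw_mul hQS hW i (fun z => if z = z₀ then 1 else 0)
  have h2 := sum_prod_mul_apply (fun _ : Fin n => Q) (fun _ => hQ.2) i
    (fun z => if z = z₀ then 1 else 0)
  simp only [mul_ite, mul_one, mul_zero, Finset.sum_ite_eq', Finset.mem_univ, if_true] at h1 h2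
  rw [← h1, ← h2, ← Finset.sum_sub_distrib]
  refine (Finset.abs_sum_le_sum_abs _ _).trans (Finset.sum_le_sum fun z _ => ?_)
  split_ifs
  · rfl
  · simp

/-- The input law averaged over time. -/
noncomputable def meanInputLaw (QS : 𝒮 → ℝ) (x : 𝒳) : ℝ := (1 / (n : ℝ)) * ∑ i, c.inputLaw QS i x

lemma sum_meanInputLaw_mul (φ : 𝒳 → ℝ) :
    ∑ x, c.meanInputLaw QS x * φ x = (1 / (n : ℝ)) * ∑ i, ∑ x, c.inputLaw QS i x * φ x := by
  simp only [meanInputLaw, mul_assoc, Finset.sum_mul, ← Finset.mul_sum]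
  rw [Finset.sum_comm]

lemma meanInputLaw_mem (hQS : QS ∈ stdSimplex ℝ 𝒮) (hM : 0 < M) (hn : 0 < n) :
    c.meanInputLaw QS ∈ stdSimplex ℝ 𝒳 := by
  refine ⟨fun x => mul_nonneg (by positivity) (Finset.sum_nonneg fun i _ =>
    (c.inputLaw_mem hQS hM i).1 x), ?_⟩
  have h := c.sum_meanInputLaw_mul (QS := QS) (fun _ => 1)
  have hn' : (n : ℝ) ≠ 0 := by positivity
  simp only [mul_one, (c.inputLaw_mem hQS hM _).2] at h
  rw [h]
  simp [hn']

lemma abs_meanInputLaw_sub_le (hQS : QS ∈ stdSimplex ℝ 𝒮)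
    (hW : ∀ x s, W x s ∈ stdSimplex ℝ (𝒴 × 𝒵)) {Q : 𝒵 → ℝ} (hQ : Q ∈ stdSimplex ℝ 𝒵)
    (hn : 0 < n) (z₀ : 𝒵) :
    |∑ x, c.meanInputLaw QS x * wardenAveraged QS W x z₀ - Q z₀| ≤
      ∑ z, |c.wardenLaw QS W z - productLaw Q n z| := by
  have hn' : (0 : ℝ) < n := by positivity
  rw [c.sum_meanInputLaw_mul]
  have h1 : (1 / (n : ℝ)) * ∑ i, ∑ x, c.inputLaw QS i x * wardenAveraged QS W x z₀ - Q z₀ =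
      (1 / (n : ℝ)) * ∑ i : Fin n, (∑ x, c.inputLaw QS i x * wardenAveraged QS W x z₀ - Q z₀) := by
    rw [Finset.sum_sub_distrib]
    simp
    field_simp
  rw [h1, abs_mul, abs_of_nonneg (by positivity), one_div, inv_mul_le_iff₀ hn']
  refine (Finset.abs_sum_le_sum_abs _ _).trans
    ((Finset.sum_le_sum fun i _ => c.abs_inputLaw_sub_le hQS hW hQ i z₀).trans_eq ?_)
  simp

/-- The reference law is the output law of the mean input law. The single-code bound is linear in
the input laws, so averaging over time is exact and no concavity is needed. -/
lemma logb_le_mul_channelInfo (hQS : QS ∈ stdSimplex ℝ 𝒮)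
    (hW : ∀ x s, W x s ∈ stdSimplex ℝ (𝒴 × 𝒵)) (hM : 0 < M) (hn : 0 < n) :
    (1 - c.errorProb QS W) * Real.logb 2 M - 1 / Real.log 2 ≤
      n * channelInfo (c.meanInputLaw QS) (stateAveraged QS W) := by
  have hV := stateAveraged_mem hQS hW
  have hp := c.meanInputLaw_mem hQS hM hn
  have hl : 0 < Real.log 2 := Real.log_pos one_lt_two
  have hn' : (0 : ℝ) < n := by positivity
  have h := c.log_le_sum_inputLaw hQS hW hM (output_mem hp hV) (fun i x y hx hy =>
    output_pos hp.1 (fun x => (hV x).1) (mul_pos (by positivity) (Finset.sum_pos'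
      (fun j _ => (c.inputLaw_mem hQS hM j).1 x) ⟨i, Finset.mem_univ _, hx⟩)) hy)
  have h2 : ∀ φ : 𝒳 → ℝ, ∑ i, ∑ x, c.inputLaw QS i x * φ x =
      n * ∑ x, c.meanInputLaw QS x * φ x := fun φ => by
    rw [c.sum_meanInputLaw_mul]
    field_simp
  rw [h2] at h
  rw [channelInfo_eq _ hV]
  simp only [Real.logb, mul_div_assoc', ← Finset.sum_div]
  rw [← sub_div]
  exact div_le_div_of_nonneg_right h hl.le

end SCCode

lemma mul_le_logb_numMessages (R : ℝ) (n : ℕ) : n * R ≤ Real.logb 2 (numMessages R n) := by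
  rw [Real.le_logb_iff_rpow_le one_lt_two (by exact_mod_cast numMessages_pos R n)]
  exact Nat.le_ceil _

/-- Rates are asymptotically bounded by the mutual information for the mean input law. -/
lemma eventually_le_channelInfo {QS : 𝒮 → ℝ} {W : 𝒳 → 𝒮 → 𝒴 × 𝒵 → ℝ} (hQS : QS ∈ stdSimplex ℝ 𝒮)
    (hW : ∀ x s, W x s ∈ stdSimplex ℝ (𝒴 × 𝒵)) {R : ℝ}
    (c : ∀ n, SCCode 𝒳 𝒮 𝒴 (numMessages R n) n)
    (hc : Tendsto (fun n => (c n).errorProb QS W) atTop (𝓝 0)) {ε : ℝ} (hε : 0 < ε) :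
    ∀ᶠ n in atTop, R - ε ≤ channelInfo ((c n).meanInputLaw QS) (stateAveraged QS W) := by
  have h1 : Tendsto (fun n : ℕ => (1 - (c n).errorProb QS W) * R - 1 / Real.log 2 / n) atTop
      (𝓝 R) := by
    have := ((hc.const_sub 1).mul_const R).sub
      (tendsto_const_div_atTop_nhds_zero_nat (1 / Real.log 2))
    simpa using this
  filter_upwards [h1.eventually_const_le (show R - ε < R by linarith), eventually_gt_atTop 0,
    hc.eventually_le_const zero_lt_one] with n h2 hn hle
  refine h2.trans ?_
  have hn' : (0 : ℝ) < n := by positivity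
  have h3 := (c n).logb_le_mul_channelInfo hQS hW (numMessages_pos R n) hn
  have h4 := mul_le_mul_of_nonneg_left (mul_le_logb_numMessages R n) (sub_nonneg.2 hle)
  have h5 : (1 - (c n).errorProb QS W) * R - 1 / Real.log 2 / n =
      ((1 - (c n).errorProb QS W) * (n * R) - 1 / Real.log 2) / n := by
    field_simp
  rw [h5, div_le_iff₀ hn']
  linarith

end Converse

/-! ### Random coding bound -/

lemma sum_prod_mul_apply_mul_apply {B : Type*} [Fintype B] {n : ℕ} {q : B → ℝ}
    (hq : ∑ b, q b = 1) {i j : Fin n} (hij : i ≠ j) (φ ψ : B → ℝ) :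
    ∑ u : Fin n → B, (∏ k, q (u k)) * (φ (u i) * ψ (u j)) =
      (∑ b, q b * φ b) * ∑ b, q b * ψ b := by
  classical
  have h1 : ∀ u : Fin n → B, (∏ k, q (u k)) * (φ (u i) * ψ (u j)) =
      ∏ k, (q (u k) * ((if k = i then φ (u k) else 1) * if k = j then ψ (u k) else 1)) := by
    intro u
    rw [Finset.prod_mul_distrib, Finset.prod_mul_distrib, Finset.prod_ite_eq' Finset.univ i,
      Finset.prod_ite_eq' Finset.univ j]
    simp
  simp only [h1]
  rw [sum_prod_eq (fun k b => q b * ((if k = i then φ b else 1) * if k = j then ψ b else 1)),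
    Finset.prod_eq_mul i j hij (fun k _ hk => by simp [hk.1, hk.2, hq]) (by simp) (by simp)]
  simp [hij, hij.symm]

lemma exists_le_of_sum_mul_le {ι : Type*} [Fintype ι] {w f : ι → ℝ} (hw : w ∈ stdSimplex ℝ ι)
    {b : ℝ} (h : ∑ i, w i * f i ≤ b) : ∃ i, f i ≤ b := by
  by_contra! hf
  have h1 : ∀ i, 0 ≤ w i * (f i - b) := fun i => mul_nonneg (hw.1 i) (sub_nonneg.2 (hf i).le)
  have h2 : ∑ i, w i * (f i - b) ≤ 0 := by
    simp only [mul_sub, Finset.sum_sub_distrib, ← Finset.sum_mul, hw.2]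
    linarith
  have h3 := (Finset.sum_eq_zero_iff_of_nonneg fun i _ => h1 i).1
    (le_antisymm h2 (Finset.sum_nonneg fun i _ => h1 i))
  have h4 : ∀ i, w i = 0 := fun i => by
    rcases mul_eq_zero.1 (h3 i (Finset.mem_univ i)) with h | h
    · exact h
    · linarith [hf i]
  have := hw.2
  simp [h4] at this

open Classical in
/-- Random coding with a threshold decoder that tests membership in `T`. -/
lemma exists_code_error_le {B C : Type*} [Fintype B] [Fintype C] {p : B → ℝ}
    (hp : p ∈ stdSimplex ℝ B) {K : B → C → ℝ} (hK : ∀ b y, 0 ≤ K b y) (T : B → C → Prop)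
    {M : ℕ} (hM : 0 < M) :
    ∃ (enc : Fin M → B) (dec : C → Fin M),
      ∑ m, ∑ y, (if dec y = m then 0 else (1 / (M : ℝ)) * K (enc m) y) ≤
        ∑ b, p b * ∑ y, (if T b y then 0 else K b y) +
        (M - 1) * ∑ y, (∑ b, p b * K b y) * ∑ b, p b * if T b y then 1 else 0 := by
  have hM' : (0 : ℝ) < M := by exact_mod_cast hM
  -- Decode to the unique message whose codeword passes the test; message `0` is an arbitrary
  -- default.
  let dec : (Fin M → B) → C → Fin M := fun c y =>
    if h : ∃ m, T (c m) y ∧ ∀ m', m' ≠ m → ¬ T (c m') y then h.choose else ⟨0, hM⟩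
  have hdec : ∀ c y m, T (c m) y → (∀ m', m' ≠ m → ¬ T (c m') y) → dec c y = m := by
    intro c y m h1 h2
    have h : ∃ m, T (c m) y ∧ ∀ m', m' ≠ m → ¬ T (c m') y := ⟨m, h1, h2⟩
    simp only [dec, dif_pos h]
    by_contra hne
    exact h2 _ hne h.choose_spec.1
  -- Union bound: an error requires that the true codeword fails the test or that another codeword
  -- passes it.
  have hpt : ∀ (c : Fin M → B) (m : Fin M) (y : C),
      (if dec c y = m then 0 else (1 / (M : ℝ)) * K (c m) y) ≤
      (1 / (M : ℝ)) * ((if T (c m) y then 0 else K (c m) y) +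
        ∑ m' ∈ Finset.univ.erase m, K (c m) y * if T (c m') y then 1 else 0) := by
    intro c m y
    have hn : ∀ m', 0 ≤ K (c m) y * if T (c m') y then (1 : ℝ) else 0 := fun m' =>
      mul_nonneg (hK _ _) (by split_ifs <;> simp)
    have hs : 0 ≤ ∑ m' ∈ Finset.univ.erase m, K (c m) y * if T (c m') y then (1 : ℝ) else 0 :=
      Finset.sum_nonneg fun m' _ => hn m'
    by_cases hd : dec c y = m
    · rw [if_pos hd]
      refine mul_nonneg (by positivity) (add_nonneg ?_ hs)
      split_ifs
      · rfl
      · exact hK _ _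
    · rw [if_neg hd]
      refine mul_le_mul_of_nonneg_left ?_ (by positivity)
      by_cases h1 : T (c m) y
      · rw [if_pos h1, zero_add]
        have h2 : ∃ m', m' ≠ m ∧ T (c m') y := by
          by_contra! h3
          exact hd (hdec c y m h1 h3)
        obtain ⟨m', hne, hT⟩ := h2
        have := Finset.single_le_sum (f := fun m' => K (c m) y * if T (c m') y then (1 : ℝ) else 0)
          (fun m' _ => hn m') (Finset.mem_erase.2 ⟨hne, Finset.mem_univ m'⟩)
        simpa [hT] using this
      · rw [if_neg h1]
        linarith
  have hw : (fun c : Fin M → B => ∏ j, p (c j)) ∈ stdSimplex ℝ (Fin M → B) :=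
    ⟨fun c => Finset.prod_nonneg fun j _ => hp.1 _, by
      rw [sum_prod_eq (fun _ => p)]; simp [hp.2]⟩
  suffices hmean : ∑ c : Fin M → B, (∏ j, p (c j)) *
      ∑ m, ∑ y, (if dec c y = m then 0 else (1 / (M : ℝ)) * K (c m) y) ≤
      ∑ b, p b * ∑ y, (if T b y then 0 else K b y) +
        (M - 1) * ∑ y, (∑ b, p b * K b y) * ∑ b, p b * if T b y then 1 else 0 by
    obtain ⟨c, hc⟩ := exists_le_of_sum_mul_le hw hmean
    exact ⟨c, dec c, hc⟩
  have h1 : ∀ m y, ∑ c : Fin M → B, (∏ j, p (c j)) * ((1 / (M : ℝ)) *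
      ((if T (c m) y then 0 else K (c m) y) +
        ∑ m' ∈ Finset.univ.erase m, K (c m) y * if T (c m') y then 1 else 0)) =
      (1 / (M : ℝ)) * (∑ b, p b * (if T b y then 0 else K b y) +
        (M - 1) * ((∑ b, p b * K b y) * ∑ b, p b * if T b y then 1 else 0)) := by
    intro m y
    simp only [mul_left_comm _ (1 / (M : ℝ)), ← Finset.mul_sum, mul_add, Finset.sum_add_distrib]
    congr 2
    · exact sum_prod_mul_apply (fun _ => p) (fun _ => hp.2) m (fun b => if T b y then 0 else K b y)
    · simp only [Finset.mul_sum (s := Finset.univ.erase m)]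
      rw [Finset.sum_comm]
      -- Distinct codewords are independent, so each of the `M - 1` competitors contributes the same
      -- product.
      rw [Finset.sum_congr rfl fun m' hm' => sum_prod_mul_apply_mul_apply hp.2
        (Finset.ne_of_mem_erase hm').symm (fun b => K b y) (fun b => if T b y then 1 else 0)]
      rw [Finset.sum_const, Finset.card_erase_of_mem (Finset.mem_univ m), Finset.card_univ,
        Fintype.card_fin, nsmul_eq_mul, Nat.cast_sub hM, Nat.cast_one]
  calc _ ≤ ∑ c : Fin M → B, (∏ j, p (c j)) * ∑ m, ∑ y, ((1 / (M : ℝ)) *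
      ((if T (c m) y then 0 else K (c m) y) +
        ∑ m' ∈ Finset.univ.erase m, K (c m) y * if T (c m') y then 1 else 0)) :=
        Finset.sum_le_sum fun c _ => mul_le_mul_of_nonneg_left (Finset.sum_le_sum fun m _ =>
          Finset.sum_le_sum fun y _ => hpt c m y) (hw.1 c)
    _ = ∑ m : Fin M, ∑ y, ((1 / (M : ℝ)) * (∑ b, p b * (if T b y then 0 else K b y) +
        (M - 1) * ((∑ b, p b * K b y) * ∑ b, p b * if T b y then 1 else 0))) := by
        simp only [Finset.mul_sum (s := (Finset.univ : Finset (Fin M))),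
          Finset.mul_sum (s := (Finset.univ : Finset C))]
        rw [Finset.sum_comm]
        refine Finset.sum_congr rfl fun m _ => ?_
        rw [Finset.sum_comm]
        exact Finset.sum_congr rfl fun y _ => h1 m y
    _ = _ := by
        rw [Finset.sum_const, Finset.card_univ, Fintype.card_fin, nsmul_eq_mul, ← Finset.mul_sum,
          ← mul_assoc, mul_one_div_cancel hM'.ne', one_mul, Finset.sum_add_distrib,
          ← Finset.mul_sum]
        congr 1
        rw [Finset.sum_comm]
        simp only [Finset.mul_sum]

/-! ### Direct part of channel coding -/

section Achievability

variable {𝒳 𝒴 : Type*} [Fintype 𝒳] [Fintype 𝒴]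

open Classical in
/-- Atypical input-output pairs are improbable, by Chebyshev's inequality. -/
lemma sum_atypical_le {p : 𝒳 → ℝ} (hp : p ∈ stdSimplex ℝ 𝒳) {V : 𝒳 → 𝒴 → ℝ}
    (hV : ∀ x, V x ∈ stdSimplex ℝ 𝒴) {γ : ℝ} (hγ : γ < channelInfo p V) {n : ℕ} (hn : 0 < n) :
    ∑ b : Fin n → 𝒳, (∏ i, p (b i)) * ∑ y : Fin n → 𝒴,
      (if (2 : ℝ) ^ (n * γ) * ∏ i, ∑ x, p x * V x (y i) < ∏ i, V (b i) (y i) then 0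
        else ∏ i, V (b i) (y i)) ≤
    (∑ u : 𝒳 × 𝒴, p u.1 * V u.1 u.2 *
      (Real.logb 2 (V u.1 u.2 / ∑ x, p x * V x u.2) - channelInfo p V) ^ 2) /
        (channelInfo p V - γ) ^ 2 / n := by
  set I := channelInfo p V with hI
  set q : 𝒴 → ℝ := fun y => ∑ x, p x * V x y with hq
  set w : 𝒳 × 𝒴 → ℝ := fun u => p u.1 * V u.1 u.2 with hw
  set ℓ : 𝒳 × 𝒴 → ℝ := fun u => Real.logb 2 (V u.1 u.2 / q u.2) - I with hℓ
  have hn' : (0 : ℝ) < n := by positivity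
  have hd : 0 < I - γ := sub_pos.2 hγ
  have hwn : ∀ u, 0 ≤ w u := fun u => mul_nonneg (hp.1 _) ((hV _).1 _)
  have hw1 : ∑ u, w u = 1 := by
    rw [Fintype.sum_prod_type]
    simp only [hw, ← Finset.mul_sum, (hV _).2, mul_one, hp.2]
  have hw0 : ∑ u, w u * ℓ u = 0 := by
    simp only [hℓ, mul_sub, Finset.sum_sub_distrib, ← Finset.sum_mul, hw1, one_mul]
    rw [Fintype.sum_prod_type, hI, channelInfo_eq p hV]
    simp only [hw, mul_assoc, ← Finset.mul_sum, hq, sub_self]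
  have hvar := sum_prod_mul_sq (n := n) w hw1 ℓ hw0
  have hpt : ∀ u : Fin n → 𝒳 × 𝒴, (∏ i, p (u i).1) *
      (if (2 : ℝ) ^ (n * γ) * ∏ i, q (u i).2 < ∏ i, V (u i).1 (u i).2 then 0
        else ∏ i, V (u i).1 (u i).2) ≤
      (∏ i, w (u i)) * (∑ i, ℓ (u i)) ^ 2 / (n * (I - γ)) ^ 2 := by
    intro u
    have hprod : ∏ i, w (u i) = (∏ i, p (u i).1) * ∏ i, V (u i).1 (u i).2 := by
      simp only [hw, Finset.prod_mul_distrib]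
    have hW0 : 0 ≤ ∏ i, w (u i) := Finset.prod_nonneg fun i _ => hwn _
    split_ifs with h
    · rw [mul_zero]; positivity
    rw [← hprod]
    by_cases h0 : ∏ i, w (u i) = 0
    · simp [h0]
    have hwi : ∀ i, 0 < w (u i) := fun i => lt_of_le_of_ne (hwn _)
      (Ne.symm (Finset.prod_ne_zero_iff.1 h0 i (Finset.mem_univ i)))
    have hpi : ∀ i, 0 < p (u i).1 := fun i => lt_of_le_of_ne (hp.1 _)
      (Ne.symm (left_ne_zero_of_mul (hwi i).ne'))
    have hVi : ∀ i, 0 < V (u i).1 (u i).2 := fun i => lt_of_le_of_ne ((hV _).1 _)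
      (Ne.symm (right_ne_zero_of_mul (hwi i).ne'))
    have hqi : ∀ i, 0 < q (u i).2 := fun i => output_pos hp.1 (fun x => (hV x).1) (hpi i) (hVi i)
    have hQ : 0 < ∏ i, q (u i).2 := Finset.prod_pos fun i _ => hqi i
    have hlog : ∑ i, Real.logb 2 (V (u i).1 (u i).2 / q (u i).2) ≤ n * γ := by
      rw [← Real.logb_prod _ _ fun i _ => (div_pos (hVi i) (hqi i)).ne',
        Real.logb_le_iff_le_rpow one_lt_two (Finset.prod_pos fun i _ => div_pos (hVi i) (hqi i)),
        Finset.prod_div_distrib, div_le_iff₀ hQ]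
      exact not_lt.1 h
    -- An atypical pair has centred information density at most $-n(I-\gamma)$. Its square then
    -- dominates $(n(I-\gamma))^2$, which is Chebyshev's inequality.
    have hsum : ∑ i, ℓ (u i) ≤ -(n * (I - γ)) := by
      simp only [hℓ, Finset.sum_sub_distrib, Finset.sum_const, Finset.card_univ, Fintype.card_fin,
        nsmul_eq_mul]
      linarith
    have hpos : 0 < n * (I - γ) := mul_pos hn' hd
    rw [le_div_iff₀ (by positivity)]
    refine mul_le_mul_of_nonneg_left ?_ hW0
    nlinarith
  have hL : ∑ b : Fin n → 𝒳, (∏ i, p (b i)) * ∑ y : Fin n → 𝒴,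
      (if (2 : ℝ) ^ (n * γ) * ∏ i, q (y i) < ∏ i, V (b i) (y i) then 0
        else ∏ i, V (b i) (y i)) ≤ ∑ u : Fin n → 𝒳 × 𝒴,
          (∏ i, w (u i)) * (∑ i, ℓ (u i)) ^ 2 / (n * (I - γ)) ^ 2 := by
    simp only [Finset.mul_sum]
    rw [sum_sum_eq_sum_pair]
    exact Finset.sum_le_sum fun u _ => hpt u
  refine hL.trans_eq ?_
  rw [← Finset.sum_div, hvar]
  field_simp
  rfl

/-- The direct part of the channel coding theorem. -/
lemma plainAchievable_of_lt_channelInfo {p : 𝒳 → ℝ} (hp : p ∈ stdSimplex ℝ 𝒳) {V : 𝒳 → 𝒴 → ℝ}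
    (hV : ∀ x, V x ∈ stdSimplex ℝ 𝒴) {R : ℝ} (hR : 0 ≤ R) (hRI : R < channelInfo p V) :
    PlainAchievable V R := by
  classical
  -- The threshold exponent lies strictly between: $\gamma<I$ makes the true codeword typical, while
  -- $R<\gamma$ makes false acceptances rare.
  obtain ⟨γ, hRγ, hγ⟩ := exists_between hRI
  set σ : ℝ := (∑ u : 𝒳 × 𝒴, p u.1 * V u.1 u.2 *
      (Real.logb 2 (V u.1 u.2 / ∑ x, p x * V x u.2) - channelInfo p V) ^ 2) /
        (channelInfo p V - γ) ^ 2 with hσ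
  set q : 𝒴 → ℝ := fun y => ∑ x, p x * V x y with hq
  have hqm : q ∈ stdSimplex ℝ 𝒴 := output_mem hp hV
  have key : ∀ n : ℕ, ∃ c : PlainCode 𝒳 𝒴 (numMessages R n) n,
      0 < n → c.errorProb V ≤ σ / n + ((2 : ℝ) ^ (R - γ)) ^ n := by
    intro n
    have hpn : (fun b : Fin n → 𝒳 => ∏ i, p (b i)) ∈ stdSimplex ℝ (Fin n → 𝒳) :=
      ⟨fun c => Finset.prod_nonneg fun j _ => hp.1 _, by
        rw [sum_prod_eq (fun _ => p)]; simp [hp.2]⟩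
    obtain ⟨enc, dec, h⟩ := exists_code_error_le hpn
      (K := fun b (y : Fin n → 𝒴) => ∏ i, V (b i) (y i))
      (fun b y => Finset.prod_nonneg fun i _ => (hV _).1 _)
      (fun b y => (2 : ℝ) ^ (n * γ) * ∏ i, q (y i) < ∏ i, V (b i) (y i)) (numMessages_pos R n)
    refine ⟨⟨enc, dec⟩, fun hn => ?_⟩
    have hA := sum_atypical_le hp hV hγ hn
    refine h.trans (add_le_add (by convert hA) ?_)
    have hout : ∀ y : Fin n → 𝒴, ∑ b : Fin n → 𝒳, (∏ i, p (b i)) * ∏ i, V (b i) (y i) =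
        ∏ i, q (y i) := by
      intro y
      simp only [← Finset.prod_mul_distrib]
      exact sum_prod_eq (fun i x => p x * V x (y i))
    have h2pos : (0 : ℝ) < 2 ^ (n * γ) := by positivity
    -- On acceptance $q^n(y)<2^{-n\gamma}V^n(y|b)$, so an independent codeword passes with
    -- probability at most $2^{-n\gamma}$.
    have hconf : ∑ y : Fin n → 𝒴, (∑ b : Fin n → 𝒳, (∏ i, p (b i)) * ∏ i, V (b i) (y i)) *
        ∑ b : Fin n → 𝒳, (∏ i, p (b i)) *
          (if (2 : ℝ) ^ (n * γ) * ∏ i, q (y i) < ∏ i, V (b i) (y i) then (1 : ℝ) else 0) ≤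
        (2 ^ (n * γ))⁻¹ := by
      have h1 : ∀ y : Fin n → 𝒴, (∑ b : Fin n → 𝒳, (∏ i, p (b i)) * ∏ i, V (b i) (y i)) *
        ∑ b : Fin n → 𝒳, (∏ i, p (b i)) *
          (if (2 : ℝ) ^ (n * γ) * ∏ i, q (y i) < ∏ i, V (b i) (y i) then (1 : ℝ) else 0) ≤
          (2 ^ (n * γ))⁻¹ * ∏ i, q (y i) := by
        intro y
        have hr : (2 ^ (n * γ))⁻¹ * ∏ i, q (y i) = ∑ b : Fin n → 𝒳,
            (2 ^ (n * γ))⁻¹ * ((∏ i, p (b i)) * ∏ i, V (b i) (y i)) := by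
          rw [← hout y, Finset.mul_sum]
        rw [hout y, hr, Finset.mul_sum]
        refine Finset.sum_le_sum fun b _ => ?_
        have hb : 0 ≤ ∏ i, p (b i) := hpn.1 b
        have hVb : 0 ≤ ∏ i, V (b i) (y i) := Finset.prod_nonneg fun i _ => (hV _).1 _
        rw [inv_mul_eq_div, le_div_iff₀ h2pos]
        split_ifs with ht
        · nlinarith [mul_le_mul_of_nonneg_left ht.le hb]
        · simpa using mul_nonneg hb hVb
      refine (Finset.sum_le_sum fun y _ => h1 y).trans_eq ?_
      rw [← Finset.mul_sum, sum_prod_eq (fun _ => q)]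
      simp [hqm.2]
    have hcount : (numMessages R n : ℝ) - 1 ≤ 2 ^ (n * R) := by
      have := (Nat.ceil_lt_add_one (show (0 : ℝ) ≤ 2 ^ ((n : ℝ) * R) by positivity)).le
      unfold numMessages
      linarith
    have hcount0 : (0 : ℝ) ≤ (numMessages R n : ℝ) - 1 := by
      have : (1 : ℝ) ≤ numMessages R n := by exact_mod_cast numMessages_pos R n
      linarith
    calc _ ≤ ((numMessages R n : ℝ) - 1) * (2 ^ (n * γ))⁻¹ := 
          mul_le_mul_of_nonneg_left (by convert hconf) hcount0
      _ ≤ 2 ^ (n * R) * (2 ^ (n * γ))⁻¹ := mul_le_mul_of_nonneg_right hcount (by positivity)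
      _ = _ := by
        rw [← Real.rpow_natCast, ← Real.rpow_mul zero_le_two, ← Real.rpow_neg zero_le_two,
          ← Real.rpow_add zero_lt_two]
        congr 1
        ring
  choose c hc using key
  refine ⟨hR, c, ?_⟩
  have hlim : Tendsto (fun n : ℕ => σ / n + ((2 : ℝ) ^ (R - γ)) ^ n) atTop (𝓝 0) := by
    have := (tendsto_const_div_atTop_nhds_zero_nat σ).add (tendsto_pow_atTop_nhds_zero_of_lt_one
      (show (0 : ℝ) ≤ 2 ^ (R - γ) by positivity)
      (Real.rpow_lt_one_of_one_lt_of_neg one_lt_two (by linarith)))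
    simpa using this
  refine tendsto_of_tendsto_of_tendsto_of_le_of_le' tendsto_const_nhds hlim
    (Eventually.of_forall fun n => ?_) ((eventually_gt_atTop 0).mono fun n hn => hc n hn)
  refine Finset.sum_nonneg fun m _ => Finset.sum_nonneg fun y _ => ?_
  split_ifs
  · rfl
  · exact mul_nonneg (by positivity) (Finset.prod_nonneg fun i _ => (hV _).1 _)

end Achievability

/-! ### The two capacity statements -/

section Capacity

variable {𝒳 𝒮 𝒴 𝒵 : Type*} [Fintype 𝒳] [Fintype 𝒮] [Fintype 𝒴] [Fintype 𝒵]

/-- A plain code, used with state information that the encoder ignores. -/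
noncomputable def PlainCode.toSCCode {M n : ℕ} (𝒮 : Type*) (c : PlainCode 𝒳 𝒴 M n) :
    SCCode 𝒳 𝒮 𝒴 M n where
  seeds := 1
  seedLaw := fun _ => 1
  seedLaw_mem := ⟨fun _ => zero_le_one, by simp⟩
  enc := fun m _ i _ => c.enc m i
  dec := c.dec

lemma PlainCode.errorProb_toSCCode {M n : ℕ} (c : PlainCode 𝒳 𝒴 M n) (QS : 𝒮 → ℝ)
    (W : 𝒳 → 𝒮 → 𝒴 × 𝒵 → ℝ) :
    (c.toSCCode 𝒮).errorProb QS W = c.errorProb (stateAveraged QS W) := by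
  have h : ∀ m (y : Fin n → 𝒴), ∑ s : Fin n → 𝒮, ∑ z : Fin n → 𝒵,
      ∏ i, (QS (s i) * W (c.enc m i) (s i) (y i, z i)) =
      ∏ i, stateAveraged QS W (c.enc m i) (y i) := by
    intro m y
    rw [sum_sum_eq_sum_pair,
      sum_prod_eq (fun i (u : 𝒮 × 𝒵) => QS u.1 * W (c.enc m i) u.1 (y i, u.2))]
    simp only [stateAveraged, Fintype.sum_prod_type, Finset.mul_sum]
  unfold SCCode.errorProb PlainCode.errorProb
  refine Finset.sum_congr rfl fun m _ => ?_
  change ∑ _θ : Fin 1, _ = _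
  rw [Fin.sum_univ_one, Finset.sum_comm]
  refine Finset.sum_congr rfl fun y _ => ?_
  change (∑ s : Fin n → 𝒮, ∑ z : Fin n → 𝒵, if c.dec y = m then 0 else
    (1 / (M : ℝ)) * 1 * ∏ i, (QS (s i) * W (c.enc m i) (s i) (y i, z i))) = _
  split_ifs
  · simp
  · rw [← h, mul_one]
    simp only [Finset.mul_sum]

lemma PlainAchievable.scAchievable {QS : 𝒮 → ℝ} {W : 𝒳 → 𝒮 → 𝒴 × 𝒵 → ℝ} {R : ℝ}
    (h : PlainAchievable (stateAveraged QS W) R) : SCAchievable QS W R := by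
  obtain ⟨hR, c, hc⟩ := h
  refine ⟨hR, fun n => (c n).toSCCode 𝒮, ?_⟩
  simpa only [PlainCode.errorProb_toSCCode] using hc

lemma plainAchievable_zero [Nonempty 𝒳] (V : 𝒳 → 𝒴 → ℝ) : PlainAchievable V 0 := by
  have h1 : ∀ n, numMessages 0 n = 1 := fun n => by simp [numMessages]
  have : ∀ n, Subsingleton (Fin (numMessages 0 n)) := fun n => by
    rw [h1]; infer_instance
  refine ⟨le_rfl, fun n => ⟨fun _ _ => Classical.arbitrary 𝒳, fun _ => ⟨0, numMessages_pos 0 n⟩⟩, ?_⟩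
  refine tendsto_const_nhds.congr fun n => ?_
  unfold PlainCode.errorProb
  refine (Finset.sum_eq_zero fun m _ => Finset.sum_eq_zero fun y _ => ?_).symm
  exact if_pos (Subsingleton.elim _ _)

/-- Strictly causal state information at the transmitter does not increase the capacity. -/
theorem scCapacity_eq_plainCapacity [Nonempty 𝒳] {QS : 𝒮 → ℝ} (hQS : QS ∈ stdSimplex ℝ 𝒮)
    {W : 𝒳 → 𝒮 → 𝒴 × 𝒵 → ℝ} (hW : ∀ x s, W x s ∈ stdSimplex ℝ (𝒴 × 𝒵)) :
    scCapacity QS W = plainCapacity (stateAveraged QS W) := by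
  refine le_antisymm (sSup_le ?_) (sSup_le_sSup (Set.image_mono fun R hR => hR.scAchievable))
  rintro _ ⟨R, ⟨hR, c, hc⟩, rfl⟩
  have hle : ∀ R' : ℝ, PlainAchievable (stateAveraged QS W) R' →
      (R' : EReal) ≤ plainCapacity (stateAveraged QS W) := fun R' h => le_sSup ⟨R', h, rfl⟩
  refine le_of_forall_lt fun a ha => ?_
  have h0 := hle 0 (plainAchievable_zero _)
  -- Achievable rates are nonnegative by definition, so negative `a` is handled by the rate-zero
  -- code.
  by_cases ha0 : a < 0
  · exact lt_of_lt_of_le ha0 (by simpa using h0)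
  obtain ⟨R', haR', hR'R⟩ := EReal.lt_iff_exists_real_btwn.1 ha
  have hR'0 : 0 ≤ R' := by
    have : (0 : EReal) ≤ (R' : EReal) := (not_lt.1 ha0).trans haR'.le
    exact_mod_cast this
  have hR'R' : R' < R := EReal.coe_lt_coe_iff.1 hR'R
  -- A single block length suffices: its mean input law has mutual information at least
  -- $(R+R')/2>R'$, and random coding with that law achieves `R'`.
  obtain ⟨n, hn, hn0⟩ := ((eventually_le_channelInfo hQS hW c hc
    (show 0 < (R - R') / 2 by linarith)).and (eventually_gt_atTop 0)).exists
  exact haR'.trans_le (hle R' (plainAchievable_of_lt_channelInfo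
    ((c n).meanInputLaw_mem hQS (numMessages_pos R n) hn0) (stateAveraged_mem hQS hW) hR'0
    (by linarith)))

/-- The input laws under which the warden observes the innocent law. -/
def covertInputs (QS : 𝒮 → ℝ) (W : 𝒳 → 𝒮 → 𝒴 × 𝒵 → ℝ) (x₀ : 𝒳) : Set (𝒳 → ℝ) :=
  {p | p ∈ stdSimplex ℝ 𝒳 ∧ ∀ z, ∑ x, p x * wardenAveraged QS W x z = innocentLaw QS W x₀ z}

lemma isCompact_covertInputs (QS : 𝒮 → ℝ) (W : 𝒳 → 𝒮 → 𝒴 × 𝒵 → ℝ) (x₀ : 𝒳) :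
    IsCompact (covertInputs QS W x₀) := by
  refine (isCompact_stdSimplex ℝ 𝒳).inter_right
    (t := {p | ∀ z, ∑ x, p x * wardenAveraged QS W x z = innocentLaw QS W x₀ z}) ?_
  rw [Set.ofPred_forall]
  exact isClosed_iInter fun z => isClosed_eq (by fun_prop) continuous_const

lemma single_mem_covertInputs [DecidableEq 𝒳] (QS : 𝒮 → ℝ) (W : 𝒳 → 𝒮 → 𝒴 × 𝒵 → ℝ) (x₀ : 𝒳) :
    Pi.single x₀ 1 ∈ covertInputs QS W x₀ :=
  ⟨single_mem_stdSimplex ℝ x₀, fun z => by simp [Pi.single_apply, wardenAveraged, innocentLaw]⟩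

/-- Averaging out the auxiliary variable preserves the laws of $(X,Y)$ and of $Z$. -/
lemma exists_covertInputs_of_admissible {QS : 𝒮 → ℝ} {W : 𝒳 → 𝒮 → 𝒴 × 𝒵 → ℝ} {x₀ : 𝒳}
    {k : ℕ} {P : 𝒮 → Fin k → 𝒳 → 𝒴 → 𝒵 → ℝ} (h : Admissible QS W x₀ k P) :
    ∃ p ∈ covertInputs QS W x₀, mutualInfo (fun x y => ∑ s, ∑ v, ∑ z, P s v x y z) =
      channelInfo p (stateAveraged QS W) := by
  obtain ⟨PV, hPV, PXV, hPXV, hP⟩ := h.factors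
  refine ⟨fun x => ∑ v, PV v * PXV v x, ⟨output_mem hPV hPXV, fun z => ?_⟩, ?_⟩
  · rw [← h.law_Z z]
    have h1 : ∀ s v x, ∑ y, P s v x y z = PV v * PXV v x * (QS s * ∑ y, W x s (y, z)) := by
      intro s v x
      simp only [hP, ← Finset.mul_sum]
      ring
    simp only [h1, wardenAveraged]
    rw [Finset.sum_comm]
    simp only [Finset.sum_comm (s := (Finset.univ : Finset 𝒮)), ← Finset.mul_sum]
    rw [Finset.sum_comm]
    simp only [Finset.sum_mul]
  · unfold channelInfo
    congr 1
    funext x y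
    have h1 : ∀ s v, ∑ z, P s v x y z = PV v * PXV v x * (QS s * ∑ z, W x s (y, z)) := by
      intro s v
      simp only [hP, ← Finset.mul_sum]
      ring
    simp only [h1, stateAveraged, ← Finset.sum_mul, ← Finset.mul_sum]

/-- A one-element auxiliary alphabet makes $I(V;Z)=0$, so the information constraint reduces to
$I(X;Y)\ge 0$. -/
lemma mem_rateRegion {QS : 𝒮 → ℝ} (hQS : QS ∈ stdSimplex ℝ 𝒮) {W : 𝒳 → 𝒮 → 𝒴 × 𝒵 → ℝ}
    (hW : ∀ x s, W x s ∈ stdSimplex ℝ (𝒴 × 𝒵)) {x₀ : 𝒳} {p : 𝒳 → ℝ}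
    (hp : p ∈ covertInputs QS W x₀) (h0 : 0 ≤ channelInfo p (stateAveraged QS W)) :
    channelInfo p (stateAveraged QS W) ∈ rateRegion QS W x₀ := by
  have hXY : mutualInfo (fun x y => ∑ s, ∑ _v : Fin 1, ∑ z, QS s * 1 * p x * W x s (y, z)) =
      channelInfo p (stateAveraged QS W) := by
    unfold channelInfo
    congr 1
    funext x y
    rw [stateAveraged, Finset.mul_sum]
    refine Finset.sum_congr rfl fun s _ => ?_
    rw [Fin.sum_univ_one, ← Finset.mul_sum]
    ring
  have hZ : ∀ z, ∑ s, ∑ x, ∑ y, QS s * 1 * p x * W x s (y, z) = innocentLaw QS W x₀ z := by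
    intro z
    rw [← hp.2 z, Finset.sum_comm]
    refine Finset.sum_congr rfl fun x _ => ?_
    rw [wardenAveraged, Finset.mul_sum]
    refine Finset.sum_congr rfl fun s _ => ?_
    rw [← Finset.mul_sum]
    ring
  have hQ1 : ∑ z, innocentLaw QS W x₀ z = 1 := (wardenAveraged_mem hQS hW x₀).2
  have hVZ : mutualInfo (fun (_v : Fin 1) z => ∑ s, ∑ x, ∑ y, QS s * 1 * p x * W x s (y, z)) = 0 := by
    have h : ∀ a : ℝ, a * Real.logb 2 (a / a) = 0 := fun a => by
      by_cases ha : a = 0 <;> simp [ha]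
    simp only [hZ, mutualInfo, hQ1, one_mul, Fin.sum_univ_one, h, Finset.sum_const_zero]
  refine ⟨h0, 1, fun s _ x y z => QS s * 1 * p x * W x s (y, z),
    ⟨⟨fun _ => 1, ⟨fun _ => zero_le_one, by simp⟩, fun _ => p, fun _ => hp.1, fun _ _ _ _ _ => rfl⟩,
      fun z => ?_, ?_, Fintype.card_pos_iff.2 ⟨x₀⟩⟩, hXY.ge⟩
  · simp only [Fin.sum_univ_one]
    exact hZ z
  · rw [hXY, hVZ]
    exact h0

lemma CovertAchievable.exists_covertInputs {QS : 𝒮 → ℝ} (hQS : QS ∈ stdSimplex ℝ 𝒮)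
    {W : 𝒳 → 𝒮 → 𝒴 × 𝒵 → ℝ} (hW : ∀ x s, W x s ∈ stdSimplex ℝ (𝒴 × 𝒵)) {x₀ : 𝒳}
    (hQ : ∀ z, 0 < innocentLaw QS W x₀ z) {R : ℝ} (h : CovertAchievable QS W x₀ R) :
    ∃ p ∈ covertInputs QS W x₀, R ≤ channelInfo p (stateAveraged QS W) := by
  obtain ⟨hR, c, herr, hkl⟩ := h
  set Q := innocentLaw QS W x₀ with hQdef
  have hQm : Q ∈ stdSimplex ℝ 𝒵 := wardenAveraged_mem hQS hW x₀
  have hQn : ∀ n (z : Fin n → 𝒵), 0 < productLaw Q n z := fun n z =>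
    Finset.prod_pos fun i _ => hQ _
  have hQnm : ∀ n, productLaw Q n ∈ stdSimplex ℝ (Fin n → 𝒵) := fun n =>
    ⟨fun z => (hQn n z).le, by
      simp only [productLaw]
      rw [sum_prod_eq (fun _ => Q)]; simp [hQm.2]⟩
  -- Positivity of $Q_0$ keeps the divergence finite, so the extended-real limit is a real one.
  have hkl' : Tendsto (fun n => ∑ z, (c n).wardenLaw QS W z *
      Real.logb 2 ((c n).wardenLaw QS W z / productLaw Q n z)) atTop (𝓝 0) := by
    rw [← EReal.tendsto_coe]
    refine hkl.congr fun n => ?_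
    exact if_pos fun a ha => absurd ha (hQn n a).ne'
  have hTV : Tendsto (fun n => ∑ z, |(c n).wardenLaw QS W z - productLaw Q n z|) atTop (𝓝 0) := by
    have h1 : Tendsto (fun n => √(4 * Real.log 2 * ∑ z, (c n).wardenLaw QS W z *
      Real.logb 2 ((c n).wardenLaw QS W z / productLaw Q n z))) atTop (𝓝 0) := by
      have := (hkl'.const_mul (4 * Real.log 2)).sqrt
      simpa using this
    refine squeeze_zero (fun n => Finset.sum_nonneg fun z _ => abs_nonneg _) (fun n => ?_) h1
    exact Real.le_sqrt_of_sq_le (sq_sum_abs_sub_le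
      ((c n).wardenLaw_mem hQS hW (numMessages_pos R n)) (hQnm n) (hQn n))
  -- The shift avoids block length zero, where the time average is not a probability law.
  set p : ℕ → 𝒳 → ℝ := fun n => (c (n + 1)).meanInputLaw QS with hp
  have hpm : ∀ n, p n ∈ stdSimplex ℝ 𝒳 := fun n =>
    (c (n + 1)).meanInputLaw_mem hQS (numMessages_pos R _) n.succ_pos
  obtain ⟨p', hp', φ, hφ, hlim⟩ := (isCompact_stdSimplex ℝ 𝒳).tendsto_subseq hpm
  have hφ1 : Tendsto (fun n => φ n + 1) atTop atTop :=
    (tendsto_add_atTop_nat 1).comp hφ.tendsto_atTop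
  refine ⟨p', ⟨hp', fun z => ?_⟩, ?_⟩
  · have h1 : Tendsto (fun n => ∑ x, p (φ n) x * wardenAveraged QS W x z) atTop
        (𝓝 (∑ x, p' x * wardenAveraged QS W x z)) :=
      tendsto_finsetSum _ fun x _ => ((tendsto_pi_nhds.1 hlim) x).mul_const _
    have h2 : Tendsto (fun n => ∑ x, p (φ n) x * wardenAveraged QS W x z) atTop (𝓝 (Q z)) := by
      rw [tendsto_iff_dist_tendsto_zero]
      refine squeeze_zero (fun n => dist_nonneg) (fun n => ?_) (hTV.comp hφ1)
      rw [Real.dist_eq]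
      exact (c (φ n + 1)).abs_meanInputLaw_sub_le hQS hW hQm (Nat.succ_pos _) z
    exact tendsto_nhds_unique h1 h2
  · have h1 : Tendsto (fun n => channelInfo (p (φ n)) (stateAveraged QS W)) atTop
        (𝓝 (channelInfo p' (stateAveraged QS W))) :=
      ((continuousOn_channelInfo (stateAveraged_mem hQS hW)) p' hp').tendsto.comp
        (tendsto_nhdsWithin_iff.2 ⟨hlim, Eventually.of_forall fun n => hpm _⟩)
    refine le_of_forall_pos_le_add fun ε hε => ?_
    have h2 := ge_of_tendsto h1 (hφ1.eventually (eventually_le_channelInfo hQS hW c herr hε))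
    linarith

theorem covertCapacity_le {QS : 𝒮 → ℝ} (hQS : QS ∈ stdSimplex ℝ 𝒮)
    {W : 𝒳 → 𝒮 → 𝒴 × 𝒵 → ℝ} (hW : ∀ x s, W x s ∈ stdSimplex ℝ (𝒴 × 𝒵)) {x₀ : 𝒳}
    (hQ : ∀ z, 0 < innocentLaw QS W x₀ z) :
    ∃ C : ℝ, IsGreatest (rateRegion QS W x₀) C ∧ covertCapacity QS W x₀ ≤ (C : EReal) := by
  classical
  have hV := stateAveraged_mem hQS hW
  obtain ⟨p, hp, hmax⟩ := (isCompact_covertInputs QS W x₀).exists_isMaxOn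
    ⟨_, single_mem_covertInputs QS W x₀⟩
    ((continuousOn_channelInfo hV).mono fun p hp => hp.1)
  have hmax' : ∀ p' ∈ covertInputs QS W x₀, channelInfo p' (stateAveraged QS W) ≤
      channelInfo p (stateAveraged QS W) := fun p' h => hmax h
  -- Nonnegativity of the maximum comes from comparison with the constant input $x_0$, which is
  -- covert and carries no information.
  have h0 : 0 ≤ channelInfo p (stateAveraged QS W) := by
    have := hmax' _ (single_mem_covertInputs QS W x₀)
    rwa [channelInfo_single x₀ hV] at this
  refine ⟨_, ⟨mem_rateRegion hQS hW hp h0, ?_⟩, sSup_le ?_⟩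
  · rintro R ⟨-, k, P, hP, hR⟩
    obtain ⟨p', hp', heq⟩ := exists_covertInputs_of_admissible hP
    exact hR.trans (heq.trans_le (hmax' p' hp'))
  · rintro _ ⟨R, hR, rfl⟩
    obtain ⟨p', hp', hle⟩ := hR.exists_covertInputs hQS hW hQ
    exact EReal.coe_le_coe_iff.2 (hle.trans (hmax' p' hp'))

end Capacity

end CovertSC

theorem mainTheorem11 {𝒳 𝒮 𝒴 𝒵 : Type*} [Fintype 𝒳] [Fintype 𝒮] [Fintype 𝒴] [Fintype 𝒵]
    (x₀ : 𝒳) (QS : 𝒮 → ℝ) (hQS : QS ∈ stdSimplex ℝ 𝒮)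
    (W : 𝒳 → 𝒮 → 𝒴 × 𝒵 → ℝ) (hW : ∀ x s, W x s ∈ stdSimplex ℝ (𝒴 × 𝒵)) :
    ((∀ z, 0 < innocentLaw QS W x₀ z) →
      ∃ C : ℝ, IsGreatest (rateRegion QS W x₀) C ∧ covertCapacity QS W x₀ ≤ (C : EReal)) ∧
    scCapacity QS W = plainCapacity (stateAveraged QS W) := by
  have : Nonempty 𝒳 := ⟨x₀⟩
  exact ⟨fun hQ => covertCapacity_le hQS hW hQ, scCapacity_eq_plainCapacity hQS hW⟩
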